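/- **Setting.** There are $n\ge 1$ replicas. Each transaction $\tau$ is sent at a time $t_\tau\in\mathbb R$. At each time $T$ every replica $i$ has an ordering vote $\sigma_i(T)$, a finite list of distinct transactions sent no later than $T$; if $S\le T$ then $\sigma_i(S)$ is an initial segment of $\sigma_i(T)$. *$\Delta$-synchrony:* every replica has $\tau$ in its vote before time $t_\tau+\Delta$. **Graph.** For votes $\sigma_1,\dots,\sigma_n$ let $V$ be the set of transactions that appear in every vote, and for $a\ne b$ in $V$ let $w(a,b)$ be the fraction of replicas that report $a$ before $b$. The *streamed ordering graph* has the vertex set $V\cup\{\hat v\}$ and the edge weights $w(a,b)$ for $a,b\in V$, $w(a,\hat v)=1$, and $w(\hat v,a)=1$ if some transaction that appears in some but not all votes precedes $a$ in some vote, $w(\hat v,a)=0$ otherwise. Fix an integer $k\ge1$ and replace every edge weight by a nearest multiple of $1/k$, where ties are resolved by any fixed function of the weight. With the unrounded weights put $P_b=\{x\in V\setminus\{b\}: w(x,b)=1\}$, $R_a=\{x\in V\setminus\{a\}: w(x,a)=0\}$ and $U_{a,b}=(V\setminus(R_a\cup P_b))\cup\{\hat v\}$. **Streaming Ranked Pairs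 with deferral.** The algorithm builds a graph $H$ on $V\cup\{\hat v\}$, starting with the edges $(a,\hat v)$, $a\in V$, marked determinate, and the edges $(\hat v,a)$ of weight $1$, marked *indeterminate*. It goes through the rounded weights of the edges between transactions, in decreasing order. For each rounded weight, the edges $(a,b)$ of that weight with $a\neq b$ in $V$ on which the previous invocation (the oracle) made a determinate decision (included as determinate, or rejected) first get the same decision. The remaining edges of that weight are then visited in an order in which the edges with $w(a,b)=1$ (unrounded) come first and which is otherwise arbitrary. When $(a,b)$ is visited, it is rejected if $H$ has a path of determinate edges from $b$ to $a$ with all vertices (including $a$ and $b$) in $U_{a,b}$; it is added to $H$ as determinate if $H$ has no path at all from $b$ to $a$ with all vertices in $U_{a,b}$; otherwise it is deferred. After all edges of that weight have been visited, each deferred edge is rejected if by now there is such a path of determinate edges, and otherwise it is added to $H$ and marked indeterminate. The output is a topological sort of $V$ with respect to the determinate edges, up to but not including the first transaction that is an endpoint of an indeterminate edge. **Claim.** Let the algorithm be invoked at times $T_0\le T_1\le T_2\le\cdots$, with the votes at these times, where each invocation has the previous one as its oracle (and the first one has none). Assume $\Delta$-synchrony. Then for every transaction $\tau$ and every $r$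 with $T_r\ge t_\tau+(k+2)\Delta$, a topological sort as required exists in invocation $r$, and $\tau$ is contained in the output of invocation $r$, whichever topological sort is used. -/

import Mathlib

namespace StreamingRankedPairs

/-! ### Votes and the ordering graph -/

/-- The ordering votes of `n` replicas: each one is a finite list of transactions, earliest first. -/
abbrev Votes (n : ℕ) (α : Type*) := Fin n → List α

/-- `a ≺ b` in the vote `l` (votes have no repetitions). -/
def Before {α : Type*} (l : List α) (a b : α) : Prop := [a, b].Sublist l

open Classical in
/-- Weight of `(a, b)` in the ordering graph: the fraction of replicas that report `a ≺ b`. -/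
noncomputable def weight {n : ℕ} {α : Type*} (σ : Votes n α) (a b : α) : ℚ :=
  ((Finset.univ.filter (fun i => Before (σ i) a b)).card : ℚ) / (n : ℚ)

/-- The transactions that appear in every vote. -/
def common {n : ℕ} {α : Type*} (σ : Votes n α) : Set α := {a | ∀ i, a ∈ σ i}

/-- The transactions that appear in the votes of some but not all replicas. -/
def partly {n : ℕ} {α : Type*} (σ : Votes n α) : Set α := {a | (∃ i, a ∈ σ i) ∧ ∃ i, a ∉ σ i}

/-- `P_a`: the other transactions that every replica reports before `a`. -/
def preceding {n : ℕ} {α : Type*} (σ : Votes n α) (a : α) : Set α :=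
  {x | x ∈ common σ ∧ x ≠ a ∧ weight σ x a = 1}

/-- `R_a`: the other transactions that no replica reports before `a`. -/
def subsequent {n : ℕ} {α : Type*} (σ : Votes n α) (a : α) : Set α :=
  {x | x ∈ common σ ∧ x ≠ a ∧ weight σ x a = 0}

/-! ### The streamed ordering graph

A vertex is `some a` for a transaction `a` that appears in every vote, or `none`, which is the
"future" vertex. -/

/-- Edge weights of the streamed ordering graph. -/
noncomputable def streamedWeight {n : ℕ} {α : Type*} (σ : Votes n α) :
    Option α → Option α → ℚ
  | some a, some b => weight σ a b
  | some _, none => 1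
  | none, some b =>
      open Classical in if ∃ p ∈ partly σ, ∃ i, Before (σ i) p b then 1 else 0
  | none, none => 0

/-- `ρ` rounds every number to a nearest integer multiple of `1 / k` (ties in any way). -/
def RoundsToNearest (k : ℕ) (ρ : ℚ → ℚ) : Prop :=
  ∀ x : ℚ, (∃ m : ℤ, ρ x = (m : ℚ) / (k : ℚ)) ∧ ∀ m : ℤ, |x - ρ x| ≤ |x - (m : ℚ) / (k : ℚ)|

/-- Edge weights of the streamed ordering graph, rounded by `ρ`. -/
noncomputable def roundedWeight {n : ℕ} {α : Type*} (ρ : ℚ → ℚ) (σ : Votes n α)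
    (x y : Option α) : ℚ := ρ (streamedWeight σ x y)

/-- `U_{a,b} = (V \ (R_a ∪ P_b)) ∪ {future}`. -/
def localSet {n : ℕ} {α : Type*} (σ : Votes n α) (a b : α) : Set (Option α) :=
  {none} ∪ some '' (common σ \ (subsequent σ a ∪ preceding σ b))

/-! ### The algorithm -/

/-- The state of the algorithm. The graph `H` has the edges `det ∪ indet`. -/
structure Status (α : Type*) where
  /-- edges of `H` that are marked determinate -/
  det : Set (Option α × Option α)
  /-- edges of `H` that are marked indeterminate -/
  indet : Set (Option α × Option α)
  /-- edges that have been rejected -/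
  rejected : Set (Option α × Option α)

/-- No decision at all: what the first invocation gets as its oracle. -/
def Status.empty {α : Type*} : Status α := ⟨∅, ∅, ∅⟩

/-- The edge has been decided, that is, included as determinate or rejected. -/
def Status.Decided {α : Type*} (s : Status α) (a b : α) : Prop :=
  (some a, some b) ∈ s.det ∨ (some a, some b) ∈ s.rejected

/-- There is a directed path from `x` to `y`, all of whose edges are in `S` and all of whose
vertices (`x` and `y` included) are in `U`. It is used for `x ≠ y` only. -/
def HasPath {α : Type*} (S : Set (Option α × Option α)) (U : Set (Option α))
    (x y : Option α) : Prop :=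
  Relation.TransGen (fun u v => u ∈ U ∧ v ∈ U ∧ (u, v) ∈ S) x y

/-- Initial state: edges from transactions to the future vertex are in `H`, and edges of weight 1
that leave the future vertex are in `H` and marked indeterminate. -/
def initial {n : ℕ} {α : Type*} (ρ : ℚ → ℚ) (σ : Votes n α) : Status α where
  det := {e | ∃ a ∈ common σ, e = (some a, none)}
  indet := {e | ∃ a ∈ common σ, e = (none, some a) ∧ roundedWeight ρ σ none (some a) = 1}
  rejected := ∅

/-- Copy the decisions of the previous invocation `O` on the edges in the list `L`. -/
def consult {α : Type*} (O : Status α) (L : List (α × α)) (s : Status α) : Status α where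
  det := s.det ∪ {e | ∃ p ∈ L, e = (some p.1, some p.2) ∧ e ∈ O.det}
  indet := s.indet
  rejected := s.rejected ∪ {e | ∃ p ∈ L, e = (some p.1, some p.2) ∧ e ∈ O.rejected}

open Classical in
/-- First visit to an edge: reject it if there is a determinate path back, include it as
determinate if there is no path back at all, and otherwise defer it (it stays out of `H`). -/
noncomputable def visit {n : ℕ} {α : Type*} (σ : Votes n α) (s : Status α) (p : α × α) :
    Status α :=
  if s.Decided p.1 p.2 then s
  else if HasPath s.det (localSet σ p.1 p.2) (some p.2) (some p.1) then
    { s with rejected := insert (some p.1, some p.2) s.rejected }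
  else if HasPath (s.det ∪ s.indet) (localSet σ p.1 p.2) (some p.2) (some p.1) then s
  else { s with det := insert (some p.1, some p.2) s.det }

open Classical in
/-- Second visit, to a deferred edge: reject it if there is a determinate path back by now, and
otherwise include it as indeterminate. (It cannot be included as determinate any more, because `H`
only grows, so the path back that was found on the first visit is still there.) -/
noncomputable def revisit {n : ℕ} {α : Type*} (σ : Votes n α) (s : Status α) (p : α × α) :
    Status α :=
  if s.Decided p.1 p.2 then s
  else if HasPath s.det (localSet σ p.1 p.2) (some p.2) (some p.1) then
    { s with rejected := insert (some p.1, some p.2) s.rejected }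
  else { s with indet := insert (some p.1, some p.2) s.indet }

/-- Process the edges `L` of one weight: first those that the oracle knows, then the others in the
order of `L`, where the edges that would become indeterminate are deferred to the end. -/
noncomputable def processClass {n : ℕ} {α : Type*} (σ : Votes n α) (O : Status α)
    (L : List (α × α)) (s : Status α) : Status α :=
  L.foldl (revisit σ) (L.foldl (visit σ) (consult O L s))

open Classical in
/-- The edges in `E` of rounded weight `γ`, in the order of `E`. -/
noncomputable def weightClass {n : ℕ} {α : Type*} (ρ : ℚ → ℚ) (σ : Votes n α)
    (E : List (α × α)) (γ : ℚ) : List (α × α) :=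
  E.filter (fun p => decide (roundedWeight ρ σ (some p.1) (some p.2) = γ))

/-- The rounded weights of the edges in `E`, from the largest to the smallest. -/
noncomputable def levels {n : ℕ} {α : Type*} (ρ : ℚ → ℚ) (σ : Votes n α)
    (E : List (α × α)) : List ℚ :=
  ((E.map (fun p => roundedWeight ρ σ (some p.1) (some p.2))).toFinset).sort (fun x y => y ≤ x)

/-- One invocation: votes `σ`, oracle `O` (the final state of the previous invocation), and `E`,
a list of the edges between transactions that fixes the initial order among edges of equal
weight. -/
noncomputable def invoke {n : ℕ} {α : Type*} (ρ : ℚ → ℚ) (σ : Votes n α)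
    (E : List (α × α)) (O : Status α) : Status α :=
  (levels ρ σ E).foldl (fun s γ => processClass σ O (weightClass ρ σ E γ) s) (initial ρ σ)

/-- `E` lists every edge between transactions of the streamed ordering graph once, and among edges
of equal rounded weight it lists those on which all replicas agree before the others. -/
structure IsTieBreak {n : ℕ} {α : Type*} (ρ : ℚ → ℚ) (σ : Votes n α) (E : List (α × α)) :
    Prop where
  nodup : E.Nodup
  mem_iff : ∀ a b : α, (a, b) ∈ E ↔ a ∈ common σ ∧ b ∈ common σ ∧ a ≠ b
  unanimous_first : E.Pairwise (fun p q =>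
    roundedWeight ρ σ (some p.1) (some p.2) = roundedWeight ρ σ (some q.1) (some q.2) →
      weight σ q.1 q.2 = 1 → weight σ p.1 p.2 = 1)

/-- `l` is a topological sort of the transactions in every vote, with respect to the determinate
edges. -/
structure IsTopologicalSort {n : ℕ} {α : Type*} (σ : Votes n α) (s : Status α) (l : List α) :
    Prop where
  nodup : l.Nodup
  mem_iff : ∀ a, a ∈ l ↔ a ∈ common σ
  sorted : ∀ a b, (some a, some b) ∈ s.det → Before l a b

/-- `a` borders an indeterminate edge. -/
def Borders {α : Type*} (s : Status α) (a : α) : Prop :=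
  ∃ x, (x, some a) ∈ s.indet ∨ (some a, x) ∈ s.indet

open Classical in
/-- `o` is an output in the final state `s`: a topological sort, up to but not including the first
transaction that borders an indeterminate edge. -/
def IsOutput {n : ℕ} {α : Type*} (σ : Votes n α) (s : Status α) (o : List α) : Prop :=
  ∃ l, IsTopologicalSort σ s l ∧ o = l.takeWhile (fun a => decide (¬ Borders s a))

/-! ### Executions in time -/

/-- Transactions `α` are sent by clients, and `n` replicas extend their votes as time passes. -/
structure Execution (n : ℕ) (α : Type*) where
  /-- the time at which a client sends the transaction -/
  sent : α → ℝ
  /-- the votes at a given time -/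
  votes : ℝ → Votes n α
  nodup : ∀ t i, (votes t i).Nodup
  extend : ∀ s t i, s ≤ t → votes s i <+: votes t i
  causal : ∀ t i a, a ∈ votes t i → sent a ≤ t

/-- `Δ`-synchrony: every replica has each transaction in its vote before `Δ` time has elapsed since
the transaction was sent. -/
def Execution.Synchronous {n : ℕ} {α : Type*} (X : Execution n α) (Δ : ℝ) : Prop :=
  ∀ a i, ∃ s, s < X.sent a + Δ ∧ a ∈ X.votes s i

/-- Final state of the `r`-th invocation, when the invocations happen at the times `T 0, T 1, …`
with the initial edge orders `E 0, E 1, …`, and each has the previous one as its oracle. -/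
noncomputable def Execution.status {n : ℕ} {α : Type*} (X : Execution n α) (ρ : ℚ → ℚ)
    (T : ℕ → ℝ) (E : ℕ → List (α × α)) : ℕ → Status α
  | 0 => invoke ρ (X.votes (T 0)) (E 0) Status.empty
  | r + 1 => invoke ρ (X.votes (T (r + 1))) (E (r + 1)) (X.status ρ T E r)

end StreamingRankedPairs

/-! An output can miss `τ` only if `τ` is reachable from the future vertex in the final graph
(`Sound.mem_output`). So it suffices to bound the age of the transactions reachable from there.

The invariants `Sound` describe each final state. Edges between transactions, determinate or not,
have no determinate path back. Here local and global paths amount to the same, because a vertex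
outside `U_{a,b}` is tied to `a` or `b` by a unanimous edge, which would close a cycle
(`Consistent.hasPath`, `Consistent.insert`). The deferral rule makes the tail of every indeterminate
edge reachable from the future vertex through determinate edges and indeterminate edges of strictly
larger rounded weight.

These invariants survive the copying of oracle decisions. If the transactions that are new since the
previous invocation are contracted to the future vertex, local paths of the new graph become local
paths of the oracle's graph (`Sound.collapse`), so an inclusion that was admissible then is
admissible now.

Timing: a head of an edge of weight 1 from the future vertex was sent within the last `2Δ`, and
determinate edges propagate this property. If an indeterminate edge `(p, q)` is followed by a
determinate path from `q` to `x`, then some replica reports `p` before `x`, since otherwise a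
unanimous edge would close a determinate path from `q` to `p`. So `p` was sent less than `Δ` after
`x`. Passing to the tail raises the rounded weight by at least `1/k`, so `k` such steps cover all
positive rounded weights, which gives `(k+2)Δ` (`Sound.lt_sent`). Edges of rounded weight `0` would
cost one more `Δ`; a separate argument in `Sound.not_reaches_of_old` avoids this. -/

namespace StreamingRankedPairs

/-! ### Lists without repetitions -/

section Lists

variable {α : Type*} {l l' : List α} {a b c : α}

theorem before_iff_append : Before l a b ↔ ∃ r₁ r₂, l = r₁ ++ r₂ ∧ a ∈ r₁ ∧ b ∈ r₂ := by
  simp only [Before, List.cons_sublist_iff (a := a), List.singleton_sublist]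

open Classical in
theorem before_iff_idxOf (hl : l.Nodup) : Before l a b ↔ b ∈ l ∧ l.idxOf a < l.idxOf b := by
  rw [before_iff_append]
  constructor
  · rintro ⟨r₁, r₂, rfl, ha, hb⟩
    have hb' : b ∉ r₁ := fun h => (List.nodup_append.1 hl).2.2 b h b hb rfl
    refine ⟨by simp [hb], ?_⟩
    rw [List.idxOf_append_of_mem ha, List.idxOf_append_of_notMem hb']
    have := List.idxOf_lt_length_of_mem ha
    omega
  · rintro ⟨hb, h⟩
    have hb' := List.idxOf_lt_length_of_mem hb
    refine ⟨l.take (l.idxOf b), l.drop (l.idxOf b), (List.take_append_drop _ _).symm, ?_, ?_⟩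
    · rw [List.mem_take_iff_getElem]
      exact ⟨l.idxOf a, by omega, List.getElem_idxOf (by omega)⟩
    · rw [List.mem_drop_iff_getElem]
      exact ⟨0, by omega, by simp⟩

theorem Before.mem_left (h : Before l a b) : a ∈ l := by
  obtain ⟨r₁, r₂, rfl, ha, -⟩ := before_iff_append.1 h
  simp [ha]

theorem Before.trans (hl : l.Nodup) (h : Before l a b) (h' : Before l b c) : Before l a c := by
  rw [before_iff_idxOf hl] at *
  exact ⟨h'.1, h.2.trans h'.2⟩

theorem Before.asymm (hl : l.Nodup) (h : Before l a b) : ¬ Before l b a := by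
  rw [before_iff_idxOf hl] at *
  exact fun h' => lt_asymm h.2 h'.2

theorem before_total (hl : l.Nodup) (ha : a ∈ l) (hb : b ∈ l) (hab : a ≠ b) :
    Before l a b ∨ Before l b a := by
  classical
  rw [before_iff_idxOf hl, before_iff_idxOf hl]
  have : l.idxOf a ≠ l.idxOf b := fun h => hab ((List.idxOf_inj ha).1 h)
  rcases lt_or_gt_of_ne this with h | h
  · exact Or.inl ⟨hb, h⟩
  · exact Or.inr ⟨ha, h⟩

theorem Before.mono (h : Before l a b) (hp : l <+: l') : Before l' a b :=
  List.Sublist.trans h hp.sublist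

/-- Later entries are appended at the end, so whatever precedes an entry of the prefix lies in the
prefix. -/
theorem Before.of_prefix (hl : l'.Nodup) (hp : l <+: l') (h : Before l' a b) (hb : b ∈ l) :
    Before l a b := by
  classical
  obtain ⟨r, rfl⟩ := hp
  rw [before_iff_idxOf hl] at h
  rw [before_iff_idxOf (List.nodup_append.1 hl).1]
  rw [List.idxOf_append_of_mem hb] at h
  have hb' := List.idxOf_lt_length_of_mem hb
  have ha : a ∈ l := by
    by_contra ha
    rw [List.idxOf_append_of_notMem ha] at h
    omega
  rw [List.idxOf_append_of_mem ha] at h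
  exact ⟨hb, h.2⟩

end Lists

/-! ### Weights -/

section Weights

variable {n : ℕ} {α : Type*} {σ : Votes n α} {a b c : α}

theorem weight_nonneg : 0 ≤ weight σ a b := by
  unfold weight; positivity

theorem weight_mono {σ' : Votes n α} {a' b' : α}
    (h : ∀ i, Before (σ i) a b → Before (σ' i) a' b') : weight σ a b ≤ weight σ' a' b' := by
  classical
  unfold weight
  gcongr with i
  exact h i

theorem weight_congr {σ' : Votes n α} (h : ∀ i, Before (σ i) a b ↔ Before (σ' i) a b) :
    weight σ a b = weight σ' a b :=
  le_antisymm (weight_mono fun i => (h i).1) (weight_mono fun i => (h i).2)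

theorem exists_before (h : weight σ a b ≠ 0) : ∃ i, Before (σ i) a b := by
  classical
  by_contra! hc
  apply h
  simp [weight, hc]

theorem weight_add (hn : 0 < n) (hσ : ∀ i, (σ i).Nodup) (ha : a ∈ common σ) (hb : b ∈ common σ)
    (hab : a ≠ b) : weight σ a b + weight σ b a = 1 := by
  classical
  have h : (Finset.univ.filter fun i => Before (σ i) b a) =
      Finset.univ.filter fun i => ¬ Before (σ i) a b := by
    ext i
    simp only [Finset.mem_filter, Finset.mem_univ, true_and]
    exact ⟨fun h => h.asymm (hσ i),
      fun h => (before_total (hσ i) (ha i) (hb i) hab).resolve_left h⟩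
  have h' := Finset.card_filter_add_card_filter_not (s := (Finset.univ : Finset (Fin n)))
    (fun i => Before (σ i) a b)
  unfold weight
  rw [h, ← add_div, ← Nat.cast_add]
  rw [h', Finset.card_univ, Fintype.card_fin]
  exact div_self (by positivity)

theorem weight_le_one : weight σ a b ≤ 1 := by
  classical
  unfold weight
  apply div_le_one_of_le₀ _ (by positivity)
  exact_mod_cast (Finset.card_le_univ _).trans (by simp)

theorem before_of_weight_eq_one (hn : 0 < n) (h : weight σ a b = 1) (i : Fin n) :
    Before (σ i) a b := by
  classical
  unfold weight at h
  rw [div_eq_one_iff_eq (by positivity)] at h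
  have h' : (Finset.univ.filter fun i => Before (σ i) a b).card = Fintype.card (Fin n) := by
    rw [Fintype.card_fin]
    exact_mod_cast h
  rw [Finset.card_eq_iff_eq_univ] at h'
  have := Finset.mem_univ i
  rw [← h'] at this
  simpa using this

theorem common_finite (hn : 0 < n) : (common σ).Finite :=
  (List.finite_toSet (σ ⟨0, hn⟩)).subset fun _ ha => ha ⟨0, hn⟩

theorem streamedWeight_none_eq_one : streamedWeight σ none (some a) = 1 ↔
    ∃ p ∈ partly σ, ∃ i, Before (σ i) p a := by
  simp [streamedWeight]

theorem streamedWeight_none_trans (hn : 0 < n) (hσ : ∀ i, (σ i).Nodup)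
    (h : streamedWeight σ none (some a) = 1) (hab : weight σ a b = 1) :
    streamedWeight σ none (some b) = 1 := by
  rw [streamedWeight_none_eq_one] at *
  obtain ⟨p, hp, i, hi⟩ := h
  exact ⟨p, hp, i, hi.trans (hσ i) (before_of_weight_eq_one hn hab i)⟩

end Weights

/-! ### Votes that extend earlier votes -/

section Extension

variable {n : ℕ} {α : Type*} {σ σ' : Votes n α} {a b : α}

theorem common_mono (h : ∀ i, σ i <+: σ' i) : common σ ⊆ common σ' :=
  fun _ ha i => (h i).subset (ha i)

/-- Once every vote contains `b`, what precedes `b` is frozen. Only the head of the edge has to be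
old. -/
theorem weight_extend (h : ∀ i, σ i <+: σ' i) (hσ : ∀ i, (σ' i).Nodup) (hb : b ∈ common σ) :
    weight σ' a b = weight σ a b :=
  weight_congr fun i => ⟨fun hi => hi.of_prefix (hσ i) (h i) (hb i), fun hi => hi.mono (h i)⟩

/-- The purpose of the future vertex: a newcomer that some replica puts before an old `b` was
already in the earlier vote of that replica, so the edge from the future vertex to `b` stands for
it. -/
theorem streamedWeight_none_of_before (h : ∀ i, σ i <+: σ' i) (hσ : ∀ i, (σ' i).Nodup)
    (ha : a ∉ common σ) (hb : b ∈ common σ) {i : Fin n} (hab : Before (σ' i) a b) :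
    streamedWeight σ none (some b) = 1 := by
  rw [streamedWeight_none_eq_one]
  have hi := hab.of_prefix (hσ i) (h i) (hb i)
  refine ⟨a, ⟨⟨i, hi.mem_left⟩, ?_⟩, i, hi⟩
  simpa [common] using ha

theorem streamedWeight_none_of_extend (h : ∀ i, σ i <+: σ' i) (hσ : ∀ i, (σ' i).Nodup)
    (hb : b ∈ common σ) (hw : streamedWeight σ' none (some b) = 1) :
    streamedWeight σ none (some b) = 1 := by
  obtain ⟨p, ⟨-, j, hj⟩, i, hi⟩ := streamedWeight_none_eq_one.1 hw
  exact streamedWeight_none_of_before h hσ (fun hp => hj ((h j).subset (hp j))) hb hi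

theorem mem_localSet_some {x : α} : some x ∈ localSet σ a b ↔
    x ∈ common σ ∧ ¬ (x ≠ a ∧ weight σ x a = 0) ∧ ¬ (x ≠ b ∧ weight σ x b = 1) := by
  simp only [localSet, subsequent, preceding, Set.singleton_union, Set.mem_insert_iff,
    reduceCtorEq, Set.mem_image, Set.mem_sdiff, Set.mem_union, Set.mem_ofPred_eq, Option.some.injEq,
    exists_eq_right, false_or]
  tauto

theorem none_mem_localSet : none ∈ localSet σ a b := by simp [localSet]

theorem mem_localSet_extend (h : ∀ i, σ i <+: σ' i) (hσ : ∀ i, (σ' i).Nodup)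
    (ha : a ∈ common σ) (hb : b ∈ common σ) {x : α} (hx : x ∈ common σ) :
    some x ∈ localSet σ' a b ↔ some x ∈ localSet σ a b := by
  simp only [mem_localSet_some, weight_extend h hσ ha, weight_extend h hσ hb, hx,
    common_mono h hx]

theorem localSet_subset_extend (h : ∀ i, σ i <+: σ' i) (hσ : ∀ i, (σ' i).Nodup)
    (ha : a ∈ common σ) (hb : b ∈ common σ) : localSet σ a b ⊆ localSet σ' a b := by
  rintro (_ | x) hx
  · exact none_mem_localSet
  · exact (mem_localSet_extend h hσ ha hb (mem_localSet_some.1 hx).1).2 hx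

end Extension

/-! ### Rounding -/

section Rounding

variable {k : ℕ} {ρ : ℚ → ℚ}

theorem RoundsToNearest.apply_div (h : RoundsToNearest k ρ) (m : ℤ) :
    ρ ((m : ℚ) / k) = (m : ℚ) / k := by
  have := (h ((m : ℚ) / k)).2 m
  rw [sub_self, abs_zero] at this
  have := abs_eq_zero.1 (le_antisymm this (abs_nonneg _))
  linarith

theorem RoundsToNearest.apply_zero (h : RoundsToNearest k ρ) : ρ 0 = 0 := by
  simpa using h.apply_div 0

theorem RoundsToNearest.apply_one (h : RoundsToNearest k ρ) (hk : 0 < k) : ρ 1 = 1 := by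
  have := h.apply_div k
  rwa [Int.cast_natCast, div_self (by positivity)] at this

theorem RoundsToNearest.monotone (h : RoundsToNearest k ρ) : Monotone ρ := by
  intro x y hxy
  rcases hxy.eq_or_lt with rfl | hxy
  · exact le_rfl
  obtain ⟨⟨m, hm⟩, hx⟩ := h x
  obtain ⟨⟨m', hm'⟩, hy⟩ := h y
  by_contra! hlt
  have h1 := hx m'
  have h2 := hy m
  rw [← hm'] at h1
  rw [← hm] at h2
  rw [← sq_le_sq] at h1 h2
  -- The two squared inequalities add up to `(y - x) * (ρ x - ρ y) ≤ 0`, but both factors are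
  -- positive.
  nlinarith

end Rounding

/-! ### Paths -/

section Paths

variable {β : Type*}

/-- `y` can be reached from `x` by a possibly empty path with edges in `S`. -/
abbrev Reaches (S : Set (β × β)) : β → β → Prop :=
  Relation.ReflTransGen fun u v => (u, v) ∈ S

theorem Reaches.mono {S S' : Set (β × β)} (h : S ⊆ S') {x y : β} (hxy : Reaches S x y) :
    Reaches S' x y :=
  Relation.ReflTransGen.mono (fun _ _ huv => h huv) _ _ hxy

theorem Reaches.insert_cases {S : Set (β × β)} {e f x y : β} (h : Reaches (insert (e, f) S) x y) :
    Reaches S x y ∨ Reaches S x e ∧ Reaches S f y := by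
  induction h with
  | refl => exact Or.inl .refl
  | tail _ h ih =>
    rcases h with h | h
    · obtain ⟨rfl, rfl⟩ := Prod.mk.inj h
      rcases ih with ih | ih
      · exact Or.inr ⟨ih, .refl⟩
      · exact Or.inr ⟨ih.1, .refl⟩
    · rcases ih with ih | ih
      · exact Or.inl (ih.tail h)
      · exact Or.inr ⟨ih.1, ih.2.tail h⟩

/-- A path whose vertices all lie in `U`. -/
theorem Reaches.within {S : Set (β × β)} {U : Set β} {x y : β} (h : Reaches S x y)
    (hU : ∀ z, Reaches S x z → Reaches S z y → z ∈ U) :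
    Relation.ReflTransGen (fun u v => u ∈ U ∧ v ∈ U ∧ (u, v) ∈ S) x y := by
  induction h with
  | refl => exact .refl
  | @tail b c hxb hbc ih =>
    refine (ih fun z hz hz' => hU z hz (hz'.tail hbc)).tail ⟨?_, ?_, hbc⟩
    · exact hU b hxb (.single hbc)
    · exact hU c (hxb.tail hbc) .refl

/-- A path either stays in `D`, or it has a last edge outside `D`. -/
theorem Reaches.last_edge {S D : Set (β × β)} {x y : β} (h : Reaches S x y) :
    Reaches D x y ∨ ∃ u v, Reaches S x u ∧ (u, v) ∈ S ∧ (u, v) ∉ D ∧ Reaches D v y := by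
  induction h with
  | refl => exact Or.inl .refl
  | @tail b c hxb hbc ih =>
    by_cases hD : (b, c) ∈ D
    · rcases ih with ih | ⟨u, v, h1, h2, h3, h4⟩
      · exact Or.inl (ih.tail hD)
      · exact Or.inr ⟨u, v, h1, h2, h3, h4.tail hD⟩
    · exact Or.inr ⟨b, c, hxb, hbc, hD, .refl⟩

theorem Reaches.closed {S : Set (β × β)} {W : Set β} {x y : β} (h : Reaches S x y) (hx : x ∈ W)
    (hW : ∀ u v, (u, v) ∈ S → u ∈ W → v ∈ W) : y ∈ W := by
  induction h with
  | refl => exact hx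
  | tail _ h ih => exact hW _ _ h ih

end Paths

/-! ### Paths inside a vertex set. -/

section HasPath

variable {α : Type*} {S S' : Set (Option α × Option α)} {U U' : Set (Option α)} {x y : Option α}

theorem HasPath.mono (hS : S ⊆ S') (hU : U ⊆ U') (h : HasPath S U x y) : HasPath S' U' x y :=
  Relation.TransGen.mono (fun _ _ huv => ⟨hU huv.1, hU huv.2.1, hS huv.2.2⟩) _ _ h

theorem HasPath.reaches (h : HasPath S U x y) : Reaches S x y :=
  Relation.ReflTransGen.mono (fun _ _ huv => huv.2.2) _ _ h.to_reflTransGen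

theorem HasPath.right_mem (h : HasPath S U x y) : y ∈ U := by
  induction h with
  | single h => exact h.2.1
  | tail _ h _ => exact h.2.1

theorem hasPath_of_within (hxy : x ≠ y)
    (h : Relation.ReflTransGen (fun u v => u ∈ U ∧ v ∈ U ∧ (u, v) ∈ S) x y) : HasPath S U x y :=
  (Relation.reflTransGen_iff_eq_or_transGen.1 h).resolve_left hxy.symm

/-- Paths are preserved by maps that send edges to edges or collapse them. -/
theorem HasPath.map (φ : Option α → Option α) (hU : ∀ u ∈ U, φ u ∈ U')
    (hS : ∀ u v, (u, v) ∈ S → φ u = φ v ∨ (φ u, φ v) ∈ S') (hxy : φ x ≠ φ y)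
    (h : HasPath S U x y) : HasPath S' U' (φ x) (φ y) := by
  apply hasPath_of_within hxy
  clear hxy
  induction h with
  | @single b h =>
    rcases hS _ _ h.2.2 with e | e
    · rw [e]
    · exact .single ⟨hU _ h.1, hU _ h.2.1, e⟩
  | tail _ h ih =>
    rcases hS _ _ h.2.2 with e | e
    · rwa [← e]
    · exact ih.tail ⟨hU _ h.1, hU _ h.2.1, e⟩

end HasPath

/-! ### Graphs that grow without creating cycles -/

section Growth

variable {n : ℕ} {α : Type*} {σ : Votes n α}

/-- The vertices of the streamed ordering graph. -/
def vertices (σ : Votes n α) : Set (Option α) := {x | ∀ a, x = some a → a ∈ common σ}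

/-- The edges between transactions on which all replicas agree. -/
def unanimous (σ : Votes n α) : Set (Option α × Option α) :=
  {e | ∃ a b, a ∈ common σ ∧ b ∈ common σ ∧ a ≠ b ∧ weight σ a b = 1 ∧ e = (some a, some b)}

/-- The edges of `A` can be added to `G` one by one, each at a time when there is no local path
back. -/
inductive Addable (σ : Votes n α) (G : Set (Option α × Option α)) :
    Set (Option α × Option α) → Prop
  | empty : Addable σ G ∅
  | cons {A : Set (Option α × Option α)} {a b : α} : Addable σ G A → a ∈ common σ →
      b ∈ common σ → a ≠ b →
      ¬ HasPath (G ∪ unanimous σ ∪ A) (localSet σ a b) (some b) (some a) →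
      Addable σ G (insert (some a, some b) A)

/-- No edge in `R` or `I` has a path back with edges in `R`. -/
def Consistent (R I : Set (Option α × Option α)) : Prop :=
  ∀ u v, (u, v) ∈ R ∪ I → ¬ Reaches R v u

theorem Addable.exists_of_mem {G A : Set (Option α × Option α)} (h : Addable σ G A)
    {e : Option α × Option α} (he : e ∈ A) :
    ∃ a b, a ∈ common σ ∧ b ∈ common σ ∧ a ≠ b ∧ e = (some a, some b) ∧
      ¬ HasPath G (localSet σ a b) (some b) (some a) := by
  induction h with
  | empty => exact he.elim
  | @cons A a b _ ha hb hab h ih =>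
    rcases he with rfl | he
    · refine ⟨a, b, ha, hb, hab, rfl, fun hp => h (hp.mono ?_ subset_rfl)⟩
      exact Set.subset_union_left.trans Set.subset_union_left
    · exact ih he

theorem Addable.extend {σ' : Votes n α} {G G' A : Set (Option α × Option α)} (h : Addable σ G A)
    (hV : common σ ⊆ common σ')
    (hG : ∀ B ⊆ A, ∀ a b, a ∈ common σ → b ∈ common σ → a ≠ b →
      HasPath (G' ∪ unanimous σ' ∪ B) (localSet σ' a b) (some b) (some a) →
      HasPath (G ∪ unanimous σ ∪ B) (localSet σ a b) (some b) (some a)) : Addable σ' G' A := by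
  induction h with
  | empty => exact .empty
  | @cons A a b _ ha hb hab h ih =>
    have hs : A ⊆ insert (some a, some b) A := Set.subset_insert _ _
    exact .cons (ih fun B hB => hG B (hB.trans hs)) (hV ha) (hV hb) hab
      fun hp => h (hG A hs a b ha hb hab hp)

/-- `R_a` holds what all replicas put after `a`, and `P_b` what all put before `b`. So each vertex
excluded from the local set comes with a unanimous edge. -/
theorem exit_localSet (hn : 0 < n) (hσ : ∀ i, (σ i).Nodup) {a b : α} (ha : a ∈ common σ)
    (hb : b ∈ common σ) {z : Option α} (hz : z ∈ vertices σ) (hzU : z ∉ localSet σ a b) :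
    (some a, z) ∈ unanimous σ ∨ (z, some b) ∈ unanimous σ := by
  rcases z with _ | z
  · exact absurd none_mem_localSet hzU
  have hz := hz z rfl
  rw [mem_localSet_some] at hzU
  by_cases h1 : z ≠ a ∧ weight σ z a = 0
  · refine Or.inl ⟨a, z, ha, hz, h1.1.symm, ?_, rfl⟩
    have := weight_add hn hσ hz ha h1.1
    linarith [h1.2]
  · by_cases h2 : z ≠ b ∧ weight σ z b = 1
    · exact Or.inr ⟨z, b, hz, hb, h2.1, h2.2, rfl⟩
    · exact absurd ⟨hz, h1, h2⟩ hzU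

theorem mem_localSet_endpoints (hn : 0 < n) (hσ : ∀ i, (σ i).Nodup) {a b : α}
    (ha : a ∈ common σ) (hb : b ∈ common σ) (hab : a ≠ b) (hw : weight σ a b ≠ 1) :
    some a ∈ localSet σ a b ∧ some b ∈ localSet σ a b := by
  have := weight_add hn hσ ha hb hab
  simp only [mem_localSet_some]
  refine ⟨⟨ha, by simp, by simp [hw]⟩, hb, ?_, by simp⟩
  rintro ⟨-, h⟩
  apply hw
  linarith

theorem not_hasPath_of_unanimous {S : Set (Option α × Option α)} {a b : α}
    (hab : a ≠ b) (hw : weight σ a b = 1) {x : Option α} :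
    ¬ HasPath S (localSet σ a b) x (some a) := by
  intro h
  have := h.right_mem
  rw [mem_localSet_some] at this
  exact this.2.2 ⟨hab, hw⟩

theorem unanimous_subset_vertices {u v : Option α} (h : (u, v) ∈ unanimous σ) :
    u ∈ vertices σ ∧ v ∈ vertices σ := by
  obtain ⟨a, b, ha, hb, -, -, h⟩ := h
  obtain ⟨rfl, rfl⟩ := Prod.mk.inj h
  simp [vertices, ha, hb]

theorem Reaches.mem_vertices {R : Set (Option α × Option α)}
    (hR : ∀ u v, (u, v) ∈ R → u ∈ vertices σ ∧ v ∈ vertices σ) {x y : Option α}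
    (h : Reaches R x y) (hx : x ∈ vertices σ) : y ∈ vertices σ :=
  h.closed hx fun u v huv _ => (hR u v huv).2

/-- In a consistent graph, paths back are local. -/
theorem Consistent.hasPath (hn : 0 < n) (hσ : ∀ i, (σ i).Nodup)
    {R I : Set (Option α × Option α)} (hc : Consistent R I) (hU : unanimous σ ⊆ R)
    (hR : ∀ u v, (u, v) ∈ R → u ∈ vertices σ ∧ v ∈ vertices σ) {a b : α} (ha : a ∈ common σ)
    (hb : b ∈ common σ) (hab : a ≠ b) (h : Reaches R (some b) (some a)) :
    HasPath R (localSet σ a b) (some b) (some a) := by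
  refine hasPath_of_within (by simpa using hab.symm) (h.within fun z hbz hza => ?_)
  by_contra hz
  have hzV : z ∈ vertices σ := hbz.mem_vertices hR (by simp [vertices, hb])
  rcases exit_localSet hn hσ ha hb hzV hz with h' | h'
  · exact hc _ _ (Or.inl (hU h')) hza
  · exact hc _ _ (Or.inl (hU h')) hbz

/-- A violation created by `(a, b)` contains a path from `b` to `a` with at most one edge in `I`. A
vertex of it outside the local set would yield, via a unanimous edge, a violation that existed
before. So the path is local, against `h`. -/
theorem Consistent.insert (hn : 0 < n) (hσ : ∀ i, (σ i).Nodup)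
    {R I G : Set (Option α × Option α)} (hc : Consistent R I) (hU : unanimous σ ⊆ R)
    (hR : ∀ u v, (u, v) ∈ R → u ∈ vertices σ ∧ v ∈ vertices σ) {a b : α} (ha : a ∈ common σ)
    (hb : b ∈ common σ) (hab : a ≠ b) (hG : R ∪ I ⊆ G)
    (h : ¬ HasPath G (localSet σ a b) (some b) (some a)) :
    Consistent (insert (some a, some b) R) I := by
  have hno : ¬ Reaches R (some b) (some a) := fun hp =>
    h ((hc.hasPath hn hσ hU hR ha hb hab hp).mono (Set.subset_union_left.trans hG) subset_rfl)
  have hbV : some b ∈ vertices σ := by simp [vertices, hb]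
  rintro u v (huv | huv) hp
  · rcases huv with huv | huv
    · obtain ⟨rfl, rfl⟩ := Prod.mk.inj huv
      rcases hp.insert_cases with hp | hp
      · exact hno hp
      · exact hno hp.1
    · rcases hp.insert_cases with hp | hp
      · exact hc _ _ (Or.inl huv) hp
      · exact hno ((hp.2.tail huv).trans hp.1)
  · rcases hp.insert_cases with hp | ⟨hva, hbu⟩
    · exact hc _ _ (Or.inr huv) hp
    apply h
    have hback : ¬ Reaches R v u := hc _ _ (Or.inr huv)
    have hbz : ∀ z, Reaches R (some b) z → Reaches R z u → z ∈ localSet σ a b := by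
      intro z hbz hzu
      by_contra hz
      rcases exit_localSet hn hσ ha hb (hbz.mem_vertices hR hbV) hz with h' | h'
      · exact hback ((hva.tail (hU h')).trans hzu)
      · exact hc _ _ (Or.inl (hU h')) hbz
    have hvz : ∀ z, Reaches R v z → Reaches R z (some a) → z ∈ localSet σ a b := by
      intro z hvz hza
      by_contra hz
      have hzV : z ∈ vertices σ := by
        rcases Relation.ReflTransGen.cases_head hza with rfl | ⟨c, hc, -⟩
        · simp [vertices, ha]
        · exact (hR _ _ hc).1
      rcases exit_localSet hn hσ ha hb hzV hz with h' | h'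
      · exact hc _ _ (Or.inl (hU h')) hza
      · exact hback ((hvz.tail (hU h')).trans hbu)
    have h1 := hbu.within hbz
    have h2 := hva.within hvz
    have hGR : R ⊆ G := Set.subset_union_left.trans hG
    refine hasPath_of_within (by simpa using hab.symm) (Relation.ReflTransGen.trans
      (Relation.ReflTransGen.tail
        (Relation.ReflTransGen.mono (fun _ _ h => ⟨h.1, h.2.1, hGR h.2.2⟩) _ _ h1)
        ⟨hbz u hbu .refl, hvz v .refl hva, hG (Or.inr huv)⟩)
      (Relation.ReflTransGen.mono (fun _ _ h => ⟨h.1, h.2.1, hGR h.2.2⟩) _ _ h2))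

/-- The unanimous edges count here even while they are missing from the graph, since the oracle's
decisions on a class are copied before its new unanimous edges are visited. -/
theorem Addable.consistent (hn : 0 < n) (hσ : ∀ i, (σ i).Nodup)
    {R I G A : Set (Option α × Option α)} (hA : Addable σ G A) (hc : Consistent R I)
    (hU : unanimous σ ⊆ R) (hR : ∀ u v, (u, v) ∈ R → u ∈ vertices σ ∧ v ∈ vertices σ)
    (hG : R ∪ I ⊆ G ∪ unanimous σ) : Consistent (R ∪ A) I := by
  induction hA with
  | empty => simpa using hc
  | @cons A a b hA ha hb hab h ih =>
    rw [Set.union_insert]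
    refine Consistent.insert hn hσ ih (hU.trans Set.subset_union_left) ?_ ha hb hab ?_ h
    · rintro u v (huv | huv)
      · exact hR u v huv
      · obtain ⟨a', b', ha', hb', -, h', -⟩ := hA.exists_of_mem huv
        obtain ⟨rfl, rfl⟩ := Prod.mk.inj h'
        simp [vertices, ha', hb']
    · rintro e ((he | he) | he)
      · exact Or.inl (hG (Or.inl he))
      · exact Or.inr he
      · exact Or.inl (hG (Or.inr he))

end Growth

/-! ### One weight class -/

section WeightClass

variable {n : ℕ} {α : Type*} {σ : Votes n α}

/-- There is a local path from the second to the first transaction of `p`. -/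
abbrev PathBack (σ : Votes n α) (S : Set (Option α × Option α)) (p : α × α) : Prop :=
  HasPath S (localSet σ p.1 p.2) (some p.2) (some p.1)

/-- The edges of the streamed ordering graph in a list of pairs of transactions. -/
def edgesOf (L : List (α × α)) : Set (Option α × Option α) :=
  {e | ∃ p ∈ L, e = (some p.1, some p.2)}

theorem mem_edgesOf {L : List (α × α)} {p : α × α} :
    (some p.1, some p.2) ∈ edgesOf L ↔ p ∈ L := by
  constructor
  · rintro ⟨q, hq, h⟩
    obtain ⟨h1, h2⟩ := Prod.mk.inj h
    obtain rfl : p = q := Prod.ext (Option.some.inj h1) (Option.some.inj h2)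
    exact hq
  · exact fun h => ⟨p, h, rfl⟩

theorem consult_det {O s : Status α} {L : List (α × α)} :
    (consult O L s).det = s.det ∪ (edgesOf L ∩ O.det) := by
  ext e
  simp only [consult, edgesOf, Set.mem_union, Set.mem_inter_iff, Set.mem_ofPred_eq]
  refine or_congr Iff.rfl ⟨?_, ?_⟩
  · rintro ⟨p, hp, he, hO⟩
    exact ⟨⟨p, hp, he⟩, hO⟩
  · rintro ⟨⟨p, hp, he⟩, hO⟩
    exact ⟨p, hp, he, hO⟩

theorem consult_rejected {O s : Status α} {L : List (α × α)} :
    (consult O L s).rejected = s.rejected ∪ (edgesOf L ∩ O.rejected) := by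
  ext e
  simp only [consult, edgesOf, Set.mem_union, Set.mem_inter_iff, Set.mem_ofPred_eq]
  refine or_congr Iff.rfl ⟨?_, ?_⟩
  · rintro ⟨p, hp, he, hO⟩
    exact ⟨⟨p, hp, he⟩, hO⟩
  · rintro ⟨⟨p, hp, he⟩, hO⟩
    exact ⟨p, hp, he, hO⟩

/-- Invariant of the first visits to the edges of a class `L`, starting from the state `s`, when
the pairs in `L₁` have been visited. -/
structure FirstVisits (σ : Votes n α) (O s : Status α) (L L₁ : List (α × α))
    (A C : Set (Option α × Option α)) (t : Status α) : Prop where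
  det_eq : t.det = s.det ∪ A
  indet_eq : t.indet = s.indet
  rejected_eq : t.rejected = s.rejected ∪ C
  det_subset : A ⊆ edgesOf L
  oracle_det : edgesOf L ∩ O.det ⊆ A
  oracle_rejected : edgesOf L ∩ O.rejected ⊆ C
  addable : Addable σ (s.det ∪ s.indet) A
  rejected_path : ∀ e ∈ C, ∃ p ∈ L, e = (some p.1, some p.2) ∧ PathBack σ (s.det ∪ A) p
  visited : ∀ p ∈ L₁, t.Decided p.1 p.2 ∨ PathBack σ (t.det ∪ t.indet) p

theorem FirstVisits.det_of_unanimous {O s t : Status α} {L L₁ : List (α × α)}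
    {A C : Set (Option α × Option α)} (h : FirstVisits σ O s L L₁ A C t)
    (hne : ∀ p ∈ L, p.1 ≠ p.2) (hs : ∀ p ∈ L, (some p.1, some p.2) ∉ s.rejected)
    (hL₁ : ∀ p ∈ L₁, p ∈ L) {p : α × α} (hp : p ∈ L₁) (hw : weight σ p.1 p.2 = 1) :
    (some p.1, some p.2) ∈ t.det := by
  rcases h.visited p hp with (h' | h') | h'
  · exact h'
  · rw [h.rejected_eq] at h'
    rcases h' with h' | h'
    · exact absurd h' (hs p (hL₁ p hp))
    · obtain ⟨q, -, hq, hq'⟩ := h.rejected_path _ h'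
      obtain ⟨h1, h2⟩ := Prod.mk.inj hq
      obtain rfl : p = q := Prod.ext (Option.some.inj h1) (Option.some.inj h2)
      exact absurd hq' (not_hasPath_of_unanimous (hne p (hL₁ p hp)) hw)
  · exact absurd h' (not_hasPath_of_unanimous (hne p (hL₁ p hp)) hw)

theorem Status.Decided.mono {s t : Status α} (h1 : s.det ⊆ t.det) (h2 : s.rejected ⊆ t.rejected)
    {a b : α} (h : s.Decided a b) : t.Decided a b :=
  h.imp (fun h => h1 h) (fun h => h2 h)

theorem FirstVisits.step {O s t : Status α} {L L₁ L₂ : List (α × α)} {p : α × α}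
    {A C : Set (Option α × Option α)} (h : FirstVisits σ O s L L₁ A C t)
    (hL : L = L₁ ++ p :: L₂)
    (hpairs : ∀ p ∈ L, p.1 ∈ common σ ∧ p.2 ∈ common σ ∧ p.1 ≠ p.2)
    (hs : ∀ p ∈ L, (some p.1, some p.2) ∉ s.rejected)
    (hun : ∀ e ∈ unanimous σ, e ∈ s.det ∨ e ∈ edgesOf L)
    (hfirst : L.Pairwise fun p q => weight σ q.1 q.2 = 1 → weight σ p.1 p.2 = 1) :
    ∃ A' C', FirstVisits σ O s L (L₁ ++ [p]) A' C' (visit σ t p) := by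
  classical
  have hp : p ∈ L := by simp [hL]
  have hpe : (some p.1, some p.2) ∈ edgesOf L := mem_edgesOf.2 hp
  have hL₁ : ∀ p ∈ L₁, p ∈ L := fun q hq => by simp [hL, hq]
  unfold visit
  split_ifs with h1 h2 h3
  · refine ⟨A, C, { h with visited := ?_ }⟩
    intro q hq
    rcases List.mem_append.1 hq with hq | hq
    · exact h.visited q hq
    · rw [List.mem_singleton.1 hq]
      exact Or.inl h1
  · refine ⟨A, insert (some p.1, some p.2) C, ?_⟩
    refine ⟨h.det_eq, h.indet_eq, ?_, h.det_subset, h.oracle_det,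
      h.oracle_rejected.trans (Set.subset_insert _ _), h.addable, ?_, ?_⟩
    · simp only [h.rejected_eq, Set.union_insert]
    · rintro e (rfl | he)
      · exact ⟨p, hp, rfl, h.det_eq ▸ h2⟩
      · exact h.rejected_path e he
    · intro q hq
      rcases List.mem_append.1 hq with hq | hq
      · exact (h.visited q hq).imp (Or.imp id fun hd => Set.mem_insert_of_mem _ hd) id
      · rw [List.mem_singleton.1 hq]
        exact Or.inl (Or.inr (Set.mem_insert _ _))
  · refine ⟨A, C, { h with visited := ?_ }⟩
    intro q hq
    rcases List.mem_append.1 hq with hq | hq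
    · exact h.visited q hq
    · rw [List.mem_singleton.1 hq]
      exact Or.inr h3
  · have hA : A ⊆ insert (some p.1, some p.2) A := Set.subset_insert _ _
    refine ⟨insert (some p.1, some p.2) A, C, ?_⟩
    refine ⟨?_, h.indet_eq, h.rejected_eq, Set.insert_subset hpe h.det_subset,
      h.oracle_det.trans hA, h.oracle_rejected, ?_, ?_, ?_⟩
    · simp only [h.det_eq, Set.union_insert]
    · refine .cons h.addable (hpairs p hp).1 (hpairs p hp).2.1 (hpairs p hp).2.2 fun hpath => ?_
      by_cases hw : weight σ p.1 p.2 = 1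
      · exact not_hasPath_of_unanimous (hpairs p hp).2.2 hw hpath
      -- A unanimous edge is in `s.det` or in the current class. In the latter case it comes before
      -- `p`, and nothing can prevent its inclusion because its tail lies outside its own local set.
      have hsub : unanimous σ ⊆ t.det := by
        rintro e he
        rcases hun e he with he' | ⟨q, hq, rfl⟩
        · rw [h.det_eq]
          exact Or.inl he'
        obtain ⟨a, b, -, -, -, hab, heq⟩ := he
        obtain ⟨ha, hb⟩ := Prod.mk.inj heq
        rw [← Option.some.inj ha, ← Option.some.inj hb] at hab
        rw [hL] at hq hfirst
        rcases List.mem_append.1 hq with hq | hq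
        · exact h.det_of_unanimous (fun p hp => (hpairs p hp).2.2) hs hL₁ hq hab
        · rcases List.mem_cons.1 hq with rfl | hq
          · exact absurd hab hw
          · exact absurd
              ((List.pairwise_cons.1 (List.pairwise_append.1 hfirst).2.1).1 q hq hab) hw
      refine h3 (hpath.mono ?_ subset_rfl)
      rw [h.det_eq] at hsub ⊢
      rw [h.indet_eq]
      rintro e (((he | he) | he) | he)
      · exact Or.inl (Or.inl he)
      · exact Or.inr he
      · exact Or.inl (hsub he)
      · exact Or.inl (Or.inr he)
    · intro e he
      obtain ⟨q, hq, he, hq'⟩ := h.rejected_path e he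
      exact ⟨q, hq, he, hq'.mono (Set.union_subset_union_right _ hA) subset_rfl⟩
    · intro q hq
      rcases List.mem_append.1 hq with hq | hq
      · refine (h.visited q hq).imp (Or.imp (fun hd => Set.mem_insert_of_mem _ hd) id)
          fun hq => hq.mono ?_ subset_rfl
        exact Set.union_subset_union_left _ (Set.subset_insert _ _)
      · rw [List.mem_singleton.1 hq]
        exact Or.inl (Or.inl (Set.mem_insert _ _))

theorem FirstVisits.foldl {O s t : Status α} {L L₁ L₂ : List (α × α)}
    {A C : Set (Option α × Option α)} (h : FirstVisits σ O s L L₁ A C t)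
    (hL : L = L₁ ++ L₂)
    (hpairs : ∀ p ∈ L, p.1 ∈ common σ ∧ p.2 ∈ common σ ∧ p.1 ≠ p.2)
    (hs : ∀ p ∈ L, (some p.1, some p.2) ∉ s.rejected)
    (hun : ∀ e ∈ unanimous σ, e ∈ s.det ∨ e ∈ edgesOf L)
    (hfirst : L.Pairwise fun p q => weight σ q.1 q.2 = 1 → weight σ p.1 p.2 = 1) :
    ∃ A' C', FirstVisits σ O s L L A' C' (L₂.foldl (visit σ) t) := by
  induction L₂ generalizing L₁ A C t with
  | nil =>
    rw [List.append_nil] at hL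
    subst hL
    exact ⟨A, C, h⟩
  | cons p L₂ ih =>
    obtain ⟨A', C', h'⟩ := h.step hL hpairs hs hun hfirst
    exact ih h' (by simp [hL])

/-- Invariant of the second visits to the edges of a class `L`, starting from the state `s`, when
the pairs in `L₁` have been revisited. -/
structure SecondVisits (σ : Votes n α) (s : Status α) (L L₁ : List (α × α))
    (B C : Set (Option α × Option α)) (t : Status α) : Prop where
  det_eq : t.det = s.det
  indet_eq : t.indet = s.indet ∪ B
  rejected_eq : t.rejected = s.rejected ∪ C
  rejected_path : ∀ e ∈ C, ∃ p ∈ L, e = (some p.1, some p.2) ∧ PathBack σ s.det p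
  indet_path : ∀ e ∈ B, ∃ p ∈ L, e = (some p.1, some p.2) ∧ ¬ PathBack σ s.det p ∧
    PathBack σ (s.det ∪ s.indet) p
  visited : ∀ p ∈ L₁, t.Decided p.1 p.2 ∨ (some p.1, some p.2) ∈ t.indet

theorem SecondVisits.step {s t : Status α} {L L₁ : List (α × α)} {p : α × α}
    {B C : Set (Option α × Option α)} (h : SecondVisits σ s L L₁ B C t) (hp : p ∈ L)
    (hs : s.Decided p.1 p.2 ∨ PathBack σ (s.det ∪ s.indet) p) :
    ∃ B' C', SecondVisits σ s L (L₁ ++ [p]) B' C' (revisit σ t p) := by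
  classical
  unfold revisit
  split_ifs with h1 h2
  · refine ⟨B, C, { h with visited := ?_ }⟩
    intro q hq
    rcases List.mem_append.1 hq with hq | hq
    · exact h.visited q hq
    · rw [List.mem_singleton.1 hq]
      exact Or.inl h1
  · refine ⟨B, insert (some p.1, some p.2) C, h.det_eq, h.indet_eq, ?_, ?_, h.indet_path, ?_⟩
    · simp only [h.rejected_eq, Set.union_insert]
    · rintro e (rfl | he)
      · exact ⟨p, hp, rfl, h.det_eq ▸ h2⟩
      · exact h.rejected_path e he
    · intro q hq
      rcases List.mem_append.1 hq with hq | hq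
      · exact (h.visited q hq).imp (Or.imp id fun hd => Set.mem_insert_of_mem _ hd) id
      · rw [List.mem_singleton.1 hq]
        exact Or.inl (Or.inr (Set.mem_insert _ _))
  · refine ⟨insert (some p.1, some p.2) B, C, h.det_eq, ?_, h.rejected_eq, h.rejected_path, ?_, ?_⟩
    · simp only [h.indet_eq, Set.union_insert]
    · rintro e (rfl | he)
      · refine ⟨p, hp, rfl, h.det_eq ▸ h2, hs.resolve_left fun hd => h1 (hd.mono ?_ ?_)⟩
        · exact h.det_eq.superset
        · rw [h.rejected_eq]
          exact Set.subset_union_left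
      · exact h.indet_path e he
    · intro q hq
      rcases List.mem_append.1 hq with hq | hq
      · exact (h.visited q hq).imp id fun hq => Set.mem_insert_of_mem _ hq
      · rw [List.mem_singleton.1 hq]
        exact Or.inr (Set.mem_insert _ _)

theorem SecondVisits.foldl {s t : Status α} {L L₁ L₂ : List (α × α)}
    {B C : Set (Option α × Option α)} (h : SecondVisits σ s L L₁ B C t)
    (hL : L = L₁ ++ L₂) (hs : ∀ p ∈ L, s.Decided p.1 p.2 ∨ PathBack σ (s.det ∪ s.indet) p) :
    ∃ B' C', SecondVisits σ s L L B' C' (L₂.foldl (revisit σ) t) := by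
  induction L₂ generalizing L₁ B C t with
  | nil =>
    rw [List.append_nil] at hL
    subst hL
    exact ⟨B, C, h⟩
  | cons p L₂ ih =>
    have hp : p ∈ L := by simp [hL]
    obtain ⟨B', C', h'⟩ := h.step hp (hs p hp)
    exact ih h' (by simp [hL])

/-- The effect of processing one class: the edges in `A` become determinate, those in `B` become
indeterminate, and those in `C` are rejected. -/
structure ClassStep (σ : Votes n α) (O s : Status α) (L : List (α × α))
    (A B C : Set (Option α × Option α)) (t : Status α) : Prop where
  det_eq : t.det = s.det ∪ A
  indet_eq : t.indet = s.indet ∪ B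
  rejected_eq : t.rejected = s.rejected ∪ C
  det_subset : A ⊆ edgesOf L
  oracle_det : edgesOf L ∩ O.det ⊆ A
  oracle_rejected : edgesOf L ∩ O.rejected ⊆ C
  addable : Addable σ (s.det ∪ s.indet) A
  rejected_path : ∀ e ∈ C, ∃ p ∈ L, e = (some p.1, some p.2) ∧ PathBack σ (s.det ∪ A) p
  indet_path : ∀ e ∈ B, ∃ p ∈ L, e = (some p.1, some p.2) ∧ ¬ PathBack σ (s.det ∪ A) p ∧
    PathBack σ (s.det ∪ A ∪ s.indet) p
  total : ∀ p ∈ L, t.Decided p.1 p.2 ∨ (some p.1, some p.2) ∈ t.indet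
  det_of_unanimous : ∀ p ∈ L, weight σ p.1 p.2 = 1 → (some p.1, some p.2) ∈ t.det

/-- No edge becomes indeterminate during the first visits, so the path back that defers an edge uses
indeterminate edges of earlier classes only. This is what makes the inequality in
`Sound.indet_reaches` strict. -/
theorem exists_classStep {O s : Status α} {L : List (α × α)}
    (hpairs : ∀ p ∈ L, p.1 ∈ common σ ∧ p.2 ∈ common σ ∧ p.1 ≠ p.2)
    (hs : ∀ p ∈ L, (some p.1, some p.2) ∉ s.rejected)
    (hun : ∀ e ∈ unanimous σ, e ∈ s.det ∨ e ∈ edgesOf L)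
    (hfirst : L.Pairwise fun p q => weight σ q.1 q.2 = 1 → weight σ p.1 p.2 = 1)
    (hadd : Addable σ (s.det ∪ s.indet) (edgesOf L ∩ O.det))
    (hrej : ∀ p ∈ L, (some p.1, some p.2) ∈ O.rejected →
      PathBack σ (s.det ∪ (edgesOf L ∩ O.det)) p) :
    ∃ A B C, ClassStep σ O s L A B C (processClass σ O L s) := by
  have h0 : FirstVisits σ O s L [] (edgesOf L ∩ O.det) (edgesOf L ∩ O.rejected)
      (consult O L s) := by
    refine ⟨consult_det, rfl, consult_rejected, Set.inter_subset_left, subset_rfl,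
      subset_rfl, hadd, ?_, by simp⟩
    rintro e ⟨⟨p, hp, rfl⟩, he⟩
    exact ⟨p, hp, rfl, hrej p hp he⟩
  obtain ⟨A, C, h1⟩ := h0.foldl (List.nil_append L).symm hpairs hs hun hfirst
  have h2 : SecondVisits σ (L.foldl (visit σ) (consult O L s)) L [] ∅ ∅
      (L.foldl (visit σ) (consult O L s)) :=
    ⟨rfl, by simp, by simp, by simp, by simp, by simp⟩
  obtain ⟨B, C', h3⟩ := h2.foldl (List.nil_append L).symm h1.visited
  refine ⟨A, B, C ∪ C', ?_⟩
  refine ⟨h3.det_eq.trans h1.det_eq, ?_, ?_, h1.det_subset, h1.oracle_det,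
    h1.oracle_rejected.trans Set.subset_union_left, h1.addable, ?_, ?_, h3.visited, ?_⟩
  · rw [← h1.indet_eq]
    exact h3.indet_eq
  · rw [← Set.union_assoc, ← h1.rejected_eq]
    exact h3.rejected_eq
  · rintro e (he | he)
    · exact h1.rejected_path e he
    · rw [← h1.det_eq]
      exact h3.rejected_path e he
  · rw [← h1.det_eq, ← h1.indet_eq]
    exact h3.indet_path
  · intro p hp hw
    have := h1.det_of_unanimous (fun p hp => (hpairs p hp).2.2) hs (fun _ h => h) hp hw
    rw [← h3.det_eq] at this
    exact this

end WeightClass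

/-! ### Invariants of an invocation -/

section Invariants

variable {n : ℕ} {α : Type*} {σ : Votes n α} {ρ : ℚ → ℚ}

/-- The rounded weight of an edge between transactions; edges at the future vertex precede all
others. -/
noncomputable def grade (ρ : ℚ → ℚ) (σ : Votes n α) : Option α × Option α → ℚ
  | (some a, some b) => ρ (weight σ a b)
  | _ => 2

theorem grade_some (a b : α) : grade ρ σ (some a, some b) = ρ (weight σ a b) := rfl

/-- The edges between transactions of the streamed ordering graph. -/
def pairs (σ : Votes n α) : Set (α × α) := {p | p.1 ∈ common σ ∧ p.2 ∈ common σ ∧ p.1 ≠ p.2}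

/-- Invariants of the state when exactly the pairs in `M` have been processed. -/
structure Sound (ρ : ℚ → ℚ) (σ : Votes n α) (M : Set (α × α)) (s : Status α) : Prop where
  det_shape : ∀ e ∈ s.det, (∃ a ∈ common σ, e = (some a, none)) ∨
    ∃ p ∈ M, e = (some p.1, some p.2)
  indet_shape : ∀ e ∈ s.indet, (∃ a ∈ common σ, e = (none, some a) ∧
    streamedWeight σ none (some a) = 1) ∨ ∃ p ∈ M, e = (some p.1, some p.2)
  rejected_shape : ∀ e ∈ s.rejected, ∃ p ∈ M, e = (some p.1, some p.2)
  future_det : ∀ a ∈ common σ, (some a, none) ∈ s.det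
  future_indet : ∀ a ∈ common σ, streamedWeight σ none (some a) = 1 → (none, some a) ∈ s.indet
  total : ∀ p ∈ M, s.Decided p.1 p.2 ∨ (some p.1, some p.2) ∈ s.indet
  det_of_unanimous : ∀ p ∈ M, weight σ p.1 p.2 = 1 → (some p.1, some p.2) ∈ s.det
  -- The bound on the grades ensures that the next invocation has copied the whole path by the time
  -- it copies the rejection.
  rejected_path : ∀ p : α × α, (some p.1, some p.2) ∈ s.rejected →
    PathBack σ {e ∈ s.det | grade ρ σ (some p.1, some p.2) ≤ grade ρ σ e} p
  -- Edges that leave the future vertex are excluded, as each has a determinate edge back.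
  consistent : Consistent (s.det ∪ unanimous σ) {e ∈ s.indet | e.1 ≠ none}
  indet_reaches : ∀ p : α × α, (some p.1, some p.2) ∈ s.indet →
    Reaches (s.det ∪ {e ∈ s.indet | grade ρ σ (some p.1, some p.2) < grade ρ σ e})
      none (some p.1)
  -- The first set is the graph as it was before the class `γ` was processed.
  addable : ∀ γ ≤ 1, Addable σ {e ∈ s.det ∪ s.indet | γ < grade ρ σ e}
    {e ∈ s.det | grade ρ σ e = γ}

theorem some_pair_inj {p q : α × α} (h : (some p.1, some p.2) = (some q.1, some q.2)) : p = q := by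
  obtain ⟨h1, h2⟩ := Prod.mk.inj h
  exact Prod.ext (Option.some.inj h1) (Option.some.inj h2)

theorem Sound.mem_of_det {M : Set (α × α)} {s : Status α} (h : Sound ρ σ M s) {p : α × α}
    (hp : (some p.1, some p.2) ∈ s.det) : p ∈ M := by
  rcases h.det_shape _ hp with ⟨a, -, he⟩ | ⟨q, hq, he⟩
  · exact absurd (Prod.mk.inj he).2 (by simp)
  · rwa [some_pair_inj he]

theorem Sound.mem_of_indet {M : Set (α × α)} {s : Status α} (h : Sound ρ σ M s) {p : α × α}
    (hp : (some p.1, some p.2) ∈ s.indet) : p ∈ M := by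
  rcases h.indet_shape _ hp with ⟨a, -, he, -⟩ | ⟨q, hq, he⟩
  · exact absurd (Prod.mk.inj he).1 (by simp)
  · rwa [some_pair_inj he]

theorem Sound.mem_of_rejected {M : Set (α × α)} {s : Status α} (h : Sound ρ σ M s) {p : α × α}
    (hp : (some p.1, some p.2) ∈ s.rejected) : p ∈ M := by
  obtain ⟨q, hq, he⟩ := h.rejected_shape _ hp
  rwa [some_pair_inj he]

theorem Sound.not_reaches {M : Set (α × α)} {s : Status α} (h : Sound ρ σ M s) {p : α × α}
    (hp : (some p.1, some p.2) ∈ s.det ∪ s.indet) :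
    ¬ Reaches (s.det ∪ unanimous σ) (some p.2) (some p.1) :=
  h.consistent _ _ (hp.imp Or.inl fun hp => ⟨hp, by simp⟩)

theorem Sound.reaches_of_rejected {M : Set (α × α)} {s : Status α} (h : Sound ρ σ M s)
    {p : α × α} (hp : (some p.1, some p.2) ∈ s.rejected) :
    Reaches s.det (some p.2) (some p.1) :=
  (h.rejected_path p hp).reaches.mono fun _ he => he.1

theorem Sound.not_rejected {M : Set (α × α)} {s : Status α} (h : Sound ρ σ M s) {p : α × α}
    (hp : (some p.1, some p.2) ∈ s.det ∪ s.indet) : (some p.1, some p.2) ∉ s.rejected :=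
  fun hr => h.not_reaches hp ((h.reaches_of_rejected hr).mono Set.subset_union_left)

theorem Sound.weight_ne_zero (hn : 0 < n) (hσ : ∀ i, (σ i).Nodup) {M : Set (α × α)}
    (hM : M ⊆ pairs σ) {s : Status α} (h : Sound ρ σ M s) {p : α × α}
    (hp : (some p.1, some p.2) ∈ s.det ∪ s.indet) : weight σ p.1 p.2 ≠ 0 := by
  intro hw
  obtain ⟨h1, h2, h3⟩ := hM (hp.elim h.mem_of_det h.mem_of_indet)
  have := weight_add hn hσ h1 h2 h3
  exact h.not_reaches hp (.single (Or.inr ⟨p.2, p.1, h2, h1, h3.symm, by linarith, rfl⟩))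

theorem Sound.det_vertices {M : Set (α × α)} (hM : M ⊆ pairs σ) {s : Status α}
    (h : Sound ρ σ M s) {u v : Option α} (huv : (u, v) ∈ s.det) :
    u ∈ vertices σ ∧ v ∈ vertices σ := by
  rcases h.det_shape _ huv with ⟨a, ha, he⟩ | ⟨p, hp, he⟩
  · obtain ⟨rfl, rfl⟩ := Prod.mk.inj he
    simp [vertices, ha]
  · obtain ⟨rfl, rfl⟩ := Prod.mk.inj he
    simp [vertices, (hM hp).1, (hM hp).2.1]

theorem grade_some_le_one (hρ : Monotone ρ) (h1 : ρ 1 = 1) (a b : α) :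
    grade ρ σ (some a, some b) ≤ 1 :=
  (hρ weight_le_one).trans h1.le

theorem Sound.lt_grade {M : Set (α × α)} {γ : ℚ} (hγ : γ ≤ 1)
    (hM : ∀ p ∈ M, γ < grade ρ σ (some p.1, some p.2)) {s : Status α} (h : Sound ρ σ M s)
    {e : Option α × Option α} (he : e ∈ s.det ∪ s.indet) : γ < grade ρ σ e := by
  have h2 : γ < 2 := by linarith
  rcases he with he | he
  · rcases h.det_shape e he with ⟨a, -, rfl⟩ | ⟨p, hp, rfl⟩
    exacts [h2, hM p hp]
  · rcases h.indet_shape e he with ⟨a, -, rfl, -⟩ | ⟨p, hp, rfl⟩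
    exacts [h2, hM p hp]

theorem Sound.unanimous_subset (hρ1 : ρ 1 = 1) {γ : ℚ} (hγ : γ ≤ 1) {s : Status α}
    (h : Sound ρ σ {p ∈ pairs σ | γ < grade ρ σ (some p.1, some p.2)} s) {L : List (α × α)}
    (hL : ∀ p, p ∈ L ↔ p ∈ pairs σ ∧ grade ρ σ (some p.1, some p.2) = γ) :
    ∀ e ∈ unanimous σ, e ∈ s.det ∨ e ∈ edgesOf L := by
  rintro e ⟨a, b, ha, hb, hab, hw, rfl⟩
  have hp : (a, b) ∈ pairs σ := ⟨ha, hb, hab⟩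
  have hg : grade ρ σ (some a, some b) = 1 := by simp only [grade, hw, hρ1]
  rcases hγ.lt_or_eq with hlt | rfl
  · exact Or.inl (h.det_of_unanimous (a, b) ⟨hp, by rwa [hg]⟩ hw)
  · exact Or.inr ⟨(a, b), (hL _).2 ⟨hp, hg⟩, rfl⟩

theorem Sound.step (hn : 0 < n) (hσ : ∀ i, (σ i).Nodup) (hρ1 : ρ 1 = 1) {γ : ℚ} (hγ : γ ≤ 1)
    {O s t : Status α} {L : List (α × α)} {A B C : Set (Option α × Option α)}
    (h : Sound ρ σ {p ∈ pairs σ | γ < grade ρ σ (some p.1, some p.2)} s)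
    (hL : ∀ p, p ∈ L ↔ p ∈ pairs σ ∧ grade ρ σ (some p.1, some p.2) = γ)
    (hst : ClassStep σ O s L A B C t) :
    Sound ρ σ {p ∈ pairs σ | γ ≤ grade ρ σ (some p.1, some p.2)} t := by
  set M := {p ∈ pairs σ | γ < grade ρ σ (some p.1, some p.2)} with hM
  set M' := {p ∈ pairs σ | γ ≤ grade ρ σ (some p.1, some p.2)} with hM'
  have hMp : M ⊆ pairs σ := fun p hp => hp.1
  have hMM : M ⊆ M' := fun p hp => ⟨hp.1, hp.2.le⟩
  have hLM : ∀ p ∈ L, p ∈ M' := fun p hp => ⟨((hL p).1 hp).1, ((hL p).1 hp).2.ge⟩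
  have hcases : ∀ p ∈ M', p ∈ M ∨ p ∈ L := fun p hp =>
    hp.2.lt_or_eq.imp (fun h => ⟨hp.1, h⟩) fun h => (hL p).2 ⟨hp.1, h.symm⟩
  have hgs : ∀ e ∈ s.det ∪ s.indet, γ < grade ρ σ e := fun e he =>
    h.lt_grade hγ (fun p hp => hp.2) he
  have hgL : ∀ e ∈ edgesOf L, grade ρ σ e = γ := by
    rintro e ⟨p, hp, rfl⟩
    exact ((hL p).1 hp).2
  have hBL : B ⊆ edgesOf L := fun e he => by
    obtain ⟨p, hp, rfl, -⟩ := hst.indet_path e he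
    exact ⟨p, hp, rfl⟩
  have hdet : s.det ⊆ t.det := hst.det_eq ▸ Set.subset_union_left
  have hindet : s.indet ⊆ t.indet := hst.indet_eq ▸ Set.subset_union_left
  have hrej : s.rejected ⊆ t.rejected := hst.rejected_eq ▸ Set.subset_union_left
  have hgt : ∀ e ∈ t.det, γ ≤ grade ρ σ e := by
    rw [hst.det_eq]
    rintro e (he | he)
    · exact (hgs e (Or.inl he)).le
    · exact (hgL e (hst.det_subset he)).ge
  have hunt : unanimous σ ⊆ t.det := by
    intro e he
    rcases h.unanimous_subset hρ1 hγ hL e he with h' | ⟨p, hp, rfl⟩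
    · exact hdet h'
    · obtain ⟨a, b, -, -, -, hab, heq⟩ := he
      obtain rfl : p = (a, b) := some_pair_inj heq
      exact hst.det_of_unanimous _ hp hab
  have htu : t.det ∪ unanimous σ = t.det := Set.union_eq_left.2 hunt
  have hdetV : ∀ u v, (u, v) ∈ t.det → u ∈ vertices σ ∧ v ∈ vertices σ := by
    intro u v huv
    rw [hst.det_eq] at huv
    rcases huv with huv | huv
    · exact h.det_vertices hMp huv
    · obtain ⟨p, hp, he⟩ := hst.det_subset huv
      obtain ⟨rfl, rfl⟩ := Prod.mk.inj he
      have := ((hL p).1 hp).1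
      simp [vertices, this.1, this.2.1]
  have hcons : Consistent t.det {e ∈ s.indet | e.1 ≠ none} := by
    have := hst.addable.consistent hn hσ h.consistent Set.subset_union_right ?_ ?_
    · rwa [Set.union_right_comm, ← hst.det_eq, htu] at this
    · rintro u v (huv | huv)
      exacts [h.det_vertices hMp huv, unanimous_subset_vertices huv]
    · rintro e ((he | he) | he)
      exacts [Or.inl (Or.inl he), Or.inr he, Or.inl (Or.inr he.1)]
  have hno : ∀ e ∈ B, ∃ p ∈ L, e = (some p.1, some p.2) ∧
      ¬ Reaches t.det (some p.2) (some p.1) := by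
    intro e he
    obtain ⟨p, hp, he, hp', -⟩ := hst.indet_path e he
    obtain ⟨h1, h2, h3⟩ := ((hL p).1 hp).1
    refine ⟨p, hp, he, fun hr => hp' ?_⟩
    rw [← hst.det_eq]
    exact hcons.hasPath hn hσ hunt hdetV h1 h2 h3 hr
  constructor
  · rw [hst.det_eq]
    rintro e (he | he)
    · exact (h.det_shape e he).imp id fun ⟨p, hp, he⟩ => ⟨p, hMM hp, he⟩
    · obtain ⟨p, hp, he⟩ := hst.det_subset he
      exact Or.inr ⟨p, hLM p hp, he⟩
  · rw [hst.indet_eq]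
    rintro e (he | he)
    · exact (h.indet_shape e he).imp id fun ⟨p, hp, he⟩ => ⟨p, hMM hp, he⟩
    · obtain ⟨p, hp, he⟩ := hBL he
      exact Or.inr ⟨p, hLM p hp, he⟩
  · rw [hst.rejected_eq]
    rintro e (he | he)
    · obtain ⟨p, hp, he⟩ := h.rejected_shape e he
      exact ⟨p, hMM hp, he⟩
    · obtain ⟨p, hp, he, -⟩ := hst.rejected_path e he
      exact ⟨p, hLM p hp, he⟩
  · exact fun a ha => hdet (h.future_det a ha)
  · exact fun a ha hw => hindet (h.future_indet a ha hw)
  · intro p hp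
    rcases hcases p hp with hp | hp
    · exact (h.total p hp).imp (fun hd => hd.mono hdet hrej) fun h => hindet h
    · exact hst.total p hp
  · intro p hp hw
    rcases hcases p hp with hp | hp
    · exact hdet (h.det_of_unanimous p hp hw)
    · exact hst.det_of_unanimous p hp hw
  · intro p hp
    rw [hst.rejected_eq] at hp
    rcases hp with hp | hp
    · exact (h.rejected_path p hp).mono (fun e he => ⟨hdet he.1, he.2⟩) subset_rfl
    · obtain ⟨q, hq, he, hq'⟩ := hst.rejected_path _ hp
      obtain rfl := some_pair_inj he
      rw [← hst.det_eq] at hq'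
      refine hq'.mono (fun e he => ⟨he, ?_⟩) subset_rfl
      rw [((hL p).1 hq).2]
      exact hgt e he
  · rw [htu, hst.indet_eq]
    rintro u v (huv | ⟨huv | huv, hne⟩)
    · exact hcons u v (Or.inl huv)
    · exact hcons u v (Or.inr ⟨huv, hne⟩)
    · obtain ⟨p, -, he, hp⟩ := hno _ huv
      obtain ⟨rfl, rfl⟩ := Prod.mk.inj he
      exact hp
  · intro p hp
    rw [hst.indet_eq] at hp
    rcases hp with hp | hp
    · refine (h.indet_reaches p hp).mono (Set.union_subset_union hdet ?_)
      exact fun e he => ⟨hindet he.1, he.2⟩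
    · obtain ⟨q, hq, he, -, hpath⟩ := hst.indet_path _ hp
      obtain rfl := some_pair_inj he
      obtain ⟨q, -, he, hpno⟩ := hno _ hp
      obtain rfl := some_pair_inj he
      rw [← hst.det_eq] at hpath
      rw [((hL p).1 hq).2]
      -- The path back is not purely determinate, so it has a last indeterminate edge `(u, v)`,
      -- which belongs to an earlier stage. Its tail is the future vertex or reachable from it by
      -- the old invariant.
      rcases hpath.reaches.last_edge (D := t.det) with hr | ⟨u, v, -, huv, huvD, hr⟩
      · exact absurd hr hpno
      have huv := huv.resolve_left huvD
      have hedge : (u, v) ∈ t.det ∪ {e ∈ t.indet | γ < grade ρ σ e} :=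
        Or.inr ⟨hindet huv, hgs _ (Or.inr huv)⟩
      refine Relation.ReflTransGen.trans (Relation.ReflTransGen.tail ?_ hedge)
        (hr.mono Set.subset_union_left)
      rcases h.indet_shape _ huv with ⟨a, -, he, -⟩ | ⟨q, hq, he⟩
      · rw [(Prod.mk.inj he).1]
      · rw [he] at huv
        rw [(Prod.mk.inj he).1]
        refine (h.indet_reaches q huv).mono (Set.union_subset_union hdet ?_)
        exact fun e he => ⟨hindet he.1, hq.2.trans he.2⟩
  · intro γ' hγ'
    rcases lt_trichotomy γ' γ with hlt | rfl | hlt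
    · convert Addable.empty
      ext e
      simp only [Set.mem_ofPred_eq, Set.mem_empty_iff_false, iff_false, not_and]
      intro he h'
      have := hgt e he
      linarith
    · convert hst.addable using 1
      · ext e
        rw [hst.det_eq, hst.indet_eq]
        constructor
        · rintro ⟨(he | he) | (he | he), hg⟩
          · exact Or.inl he
          · exact absurd (hgL e (hst.det_subset he)) hg.ne'
          · exact Or.inr he
          · exact absurd (hgL e (hBL he)) hg.ne'
        · intro he
          exact ⟨he.imp Or.inl Or.inl, hgs e he⟩
      · ext e
        rw [hst.det_eq]
        constructor
        · rintro ⟨he | he, hg⟩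
          · exact absurd hg (hgs e (Or.inl he)).ne'
          · exact he
        · intro he
          exact ⟨Or.inr he, hgL e (hst.det_subset he)⟩
    · convert h.addable γ' hγ' using 1
      · ext e
        rw [hst.det_eq, hst.indet_eq]
        constructor
        · rintro ⟨(he | he) | (he | he), hg⟩
          · exact ⟨Or.inl he, hg⟩
          · exact absurd (hgL e (hst.det_subset he)) (hlt.trans hg).ne'
          · exact ⟨Or.inr he, hg⟩
          · exact absurd (hgL e (hBL he)) (hlt.trans hg).ne'
        · rintro ⟨he, hg⟩
          exact ⟨he.imp Or.inl Or.inl, hg⟩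
      · ext e
        rw [hst.det_eq]
        constructor
        · rintro ⟨he | he, hg⟩
          · exact ⟨he, hg⟩
          · exact absurd hg ((hgL e (hst.det_subset he)).trans_ne hlt.ne)
        · rintro ⟨he, hg⟩
          exact ⟨Or.inl he, hg⟩

/-! ### The decisions of the oracle -/

theorem grade_extend {σ' : Votes n α} (hext : ∀ i, σ i <+: σ' i) (hσ' : ∀ i, (σ' i).Nodup)
    {u v : Option α} (hv : v ∈ vertices σ) : grade ρ σ' (u, v) = grade ρ σ (u, v) := by
  rcases u with _ | a <;> rcases v with _ | b <;> try rfl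
  simp only [grade, weight_extend hext hσ' (hv b rfl)]

theorem pairs_extend {σ' : Votes n α} (hext : ∀ i, σ i <+: σ' i) : pairs σ ⊆ pairs σ' :=
  fun _ hp => ⟨common_mono hext hp.1, common_mono hext hp.2.1, hp.2.2⟩

/-- Paths of a later invocation are paths of the oracle's graph, where the transactions that are
new in the later invocation are replaced by the future vertex. -/
theorem Sound.collapse (hn : 0 < n) {σ' : Votes n α} (hext : ∀ i, σ i <+: σ' i)
    (hσ' : ∀ i, (σ' i).Nodup) {γ : ℚ} (hγ : γ ≤ 1) {O s : Status α}
    (hO : Sound ρ σ (pairs σ) O)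
    (hs : Sound ρ σ' {p ∈ pairs σ' | γ < grade ρ σ' (some p.1, some p.2)} s)
    (hOs : ∀ p ∈ pairs σ', γ < grade ρ σ' (some p.1, some p.2) →
      (some p.1, some p.2) ∈ O.rejected → (some p.1, some p.2) ∈ s.rejected)
    {D : Set (Option α × Option α)} (hD : D ⊆ O.det) {a b : α} (ha : a ∈ common σ)
    (hb : b ∈ common σ) (hab : a ≠ b)
    (hpath : HasPath (s.det ∪ s.indet ∪ unanimous σ' ∪ D) (localSet σ' a b) (some b) (some a)) :
    HasPath ({e ∈ O.det ∪ O.indet | γ < grade ρ σ e} ∪ unanimous σ ∪ D) (localSet σ a b)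
      (some b) (some a) := by
  classical
  set φ : Option α → Option α := fun x => if x ∈ vertices σ then x else none with hφ
  have hφ_of : ∀ x ∈ vertices σ, φ x = x := fun x hx => by simp [hφ, hx]
  have hφ_not : ∀ x ∉ vertices σ, φ x = none := fun x hx => by simp [hφ, hx]
  have hφ_none : φ none = none := by simp [hφ]
  have hvs : ∀ x, some x ∈ vertices σ ↔ x ∈ common σ := fun x => by simp [vertices]
  have h2 : γ < 2 := by linarith
  -- Edges at new transactions: with an old tail the image is an edge to the future vertex; with an
  -- old head it is an edge from it, present because the weight is not `0`; with neither, the edge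
  -- collapses.
  have hnew : ∀ p ∈ pairs σ', weight σ' p.1 p.2 ≠ 0 →
      ¬ (p.1 ∈ common σ ∧ p.2 ∈ common σ) → φ (some p.1) = φ (some p.2) ∨
        (φ (some p.1), φ (some p.2)) ∈
          {e ∈ O.det ∪ O.indet | γ < grade ρ σ e} ∪ unanimous σ ∪ D := by
    intro p _ hw hp'
    by_cases h1 : p.1 ∈ common σ
    · have hp2 : p.2 ∉ common σ := fun h => hp' ⟨h1, h⟩
      right
      rw [hφ_of _ ((hvs _).2 h1), hφ_not _ (mt (hvs _).1 hp2)]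
      exact Or.inl (Or.inl ⟨Or.inl (hO.future_det _ h1), h2⟩)
    · rw [hφ_not _ (mt (hvs _).1 h1)]
      by_cases hp2 : p.2 ∈ common σ
      · right
        rw [hφ_of _ ((hvs _).2 hp2)]
        obtain ⟨i, hi⟩ := exists_before hw
        refine Or.inl (Or.inl ⟨Or.inr (hO.future_indet _ hp2 ?_), h2⟩)
        exact streamedWeight_none_of_before hext hσ' h1 hp2 hi
      · exact Or.inl (hφ_not _ (mt (hvs _).1 hp2)).symm
  -- The oracle did not reject such an edge between old transactions, since the rejection would have
  -- been copied. By totality the edge is in the oracle's graph.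
  have hcore : ∀ p : α × α, (some p.1, some p.2) ∈ s.det ∪ s.indet →
      φ (some p.1) = φ (some p.2) ∨ (φ (some p.1), φ (some p.2)) ∈
        {e ∈ O.det ∪ O.indet | γ < grade ρ σ e} ∪ unanimous σ ∪ D := by
    intro p hp
    obtain ⟨hpp, hpγ⟩ := hp.elim hs.mem_of_det hs.mem_of_indet
    by_cases hold : p.1 ∈ common σ ∧ p.2 ∈ common σ
    · right
      rw [hφ_of _ ((hvs _).2 hold.1), hφ_of _ ((hvs _).2 hold.2)]
      have hrej : (some p.1, some p.2) ∉ O.rejected := fun hr =>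
        hs.not_rejected hp (hOs p hpp hpγ hr)
      have hg := grade_extend (ρ := ρ) hext hσ' (u := some p.1) ((hvs _).2 hold.2)
      refine Or.inl (Or.inl ⟨?_, by rwa [← hg]⟩)
      rcases hO.total p ⟨hold.1, hold.2, hpp.2.2⟩ with (h | h) | h
      exacts [Or.inl h, absurd h hrej, Or.inr h]
    · exact hnew p hpp (hs.weight_ne_zero hn hσ' (fun p hp => hp.1) hp) hold
  have key := hpath.map φ (U' := localSet σ a b)
    (S' := {e ∈ O.det ∪ O.indet | γ < grade ρ σ e} ∪ unanimous σ ∪ D) ?_ ?_ ?_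
  · rwa [hφ_of _ ((hvs b).2 hb), hφ_of _ ((hvs a).2 ha)] at key
  · rintro (_ | x) hx
    · rw [hφ_none]
      exact none_mem_localSet
    · by_cases hxV : x ∈ common σ
      · rw [hφ_of _ ((hvs x).2 hxV)]
        exact (mem_localSet_extend hext hσ' ha hb hxV).1 hx
      · rw [hφ_not _ (mt (hvs x).1 hxV)]
        exact none_mem_localSet
  · rintro u v (((huv | huv) | huv) | huv)
    · rcases hs.det_shape _ huv with ⟨x, -, he⟩ | ⟨p, -, he⟩
      · obtain ⟨rfl, rfl⟩ := Prod.mk.inj he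
        by_cases hx : x ∈ common σ
        · right
          rw [hφ_of _ ((hvs x).2 hx), hφ_none]
          exact Or.inl (Or.inl ⟨Or.inl (hO.future_det x hx), h2⟩)
        · left
          rw [hφ_not _ (mt (hvs x).1 hx), hφ_none]
      · obtain ⟨rfl, rfl⟩ := Prod.mk.inj he
        exact hcore p (Or.inl huv)
    · rcases hs.indet_shape _ huv with ⟨x, -, he, hw⟩ | ⟨p, -, he⟩
      · obtain ⟨rfl, rfl⟩ := Prod.mk.inj he
        by_cases hx : x ∈ common σ
        · right
          rw [hφ_of _ ((hvs x).2 hx), hφ_none]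
          exact Or.inl (Or.inl ⟨Or.inr (hO.future_indet x hx
            (streamedWeight_none_of_extend hext hσ' hx hw)), h2⟩)
        · left
          rw [hφ_not _ (mt (hvs x).1 hx), hφ_none]
      · obtain ⟨rfl, rfl⟩ := Prod.mk.inj he
        exact hcore p (Or.inr huv)
    · obtain ⟨x, y, hx, hy, hxy, hw, he⟩ := huv
      obtain ⟨rfl, rfl⟩ := Prod.mk.inj he
      by_cases hold : x ∈ common σ ∧ y ∈ common σ
      · right
        rw [hφ_of _ ((hvs x).2 hold.1), hφ_of _ ((hvs y).2 hold.2)]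
        refine Or.inl (Or.inr ⟨x, y, hold.1, hold.2, hxy, ?_, rfl⟩)
        rwa [← weight_extend hext hσ' hold.2]
      · exact hnew (x, y) ⟨hx, hy, hxy⟩ (hw.trans_ne one_ne_zero) hold
    · right
      obtain ⟨hu, hv⟩ := hO.det_vertices subset_rfl (hD huv)
      rw [hφ_of _ hu, hφ_of _ hv]
      exact Or.inr huv
  · rw [hφ_of _ ((hvs b).2 hb), hφ_of _ ((hvs a).2 ha)]
    simpa using hab.symm

end Invariants

/-! ### The invariants along a sequence of invocations. -/

section Invocations

variable {n : ℕ} {α : Type*} {σ σ' : Votes n α} {ρ : ℚ → ℚ}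

theorem weight_eq_one_trans (hn : 0 < n) (hσ : ∀ i, (σ i).Nodup) {a b c : α}
    (h : weight σ a b = 1) (h' : weight σ b c = 1) : weight σ a c = 1 := by
  refine le_antisymm weight_le_one (h'.ge.trans (weight_mono fun i hi => ?_))
  exact (before_of_weight_eq_one hn h i).trans (hσ i) hi

theorem consistent_future_unanimous (hn : 0 < n) (hσ : ∀ i, (σ i).Nodup) :
    Consistent ({e | ∃ a ∈ common σ, e = (some a, none)} ∪ unanimous σ) ∅ := by
  have hnone : ∀ {x y : Option α}, x = none →
      Reaches ({e | ∃ a ∈ common σ, e = (some a, none)} ∪ unanimous σ) x y → y = none := by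
    intro x y hx h
    refine h.closed (W := {none}) hx ?_
    rintro u v (⟨a, -, he⟩ | ⟨a, b, -, -, -, -, he⟩) hu
    · exact (Prod.mk.inj he).2
    · exact absurd ((Prod.mk.inj he).1.symm.trans hu) (by simp)
  rintro u v ((⟨a, ha, he⟩ | ⟨a, b, ha, hb, hab, hw, he⟩) | h) hr
  · obtain ⟨rfl, rfl⟩ := Prod.mk.inj he
    exact absurd (hnone rfl hr) (by simp)
  · obtain ⟨rfl, rfl⟩ := Prod.mk.inj he
    have hmem : some a ∈ {x | ∀ y, x = some y → y = b ∨ weight σ b y = 1} := by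
      refine hr.closed (fun y hy => Or.inl (Option.some.inj hy).symm) ?_
      rintro u v (⟨x, -, he⟩ | ⟨x, y, -, -, -, hxy, he⟩) hu
      · rintro z rfl
        exact absurd (Prod.mk.inj he).2 (by simp)
      · obtain ⟨rfl, rfl⟩ := Prod.mk.inj he
        rintro z hz
        obtain rfl := Option.some.inj hz
        rcases hu x rfl with rfl | hx
        · exact Or.inr hxy
        · exact Or.inr (weight_eq_one_trans hn hσ hx hxy)
    rcases hmem a rfl with h | h
    · exact hab h
    · have := weight_add hn hσ ha hb hab
      linarith
  · exact h

theorem sound_initial (hn : 0 < n) (hσ : ∀ i, (σ i).Nodup) (h0 : ρ 0 = 0) (h1 : ρ 1 = 1) :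
    Sound ρ σ ∅ (initial ρ σ) := by
  have hw : ∀ a, roundedWeight ρ σ none (some a) = 1 ↔ streamedWeight σ none (some a) = 1 := by
    intro a
    unfold roundedWeight
    simp only [streamedWeight]
    split_ifs <;> simp [h0, h1]
  constructor
  · exact fun e he => Or.inl he
  · rintro e ⟨a, ha, he, h⟩
    exact Or.inl ⟨a, ha, he, (hw a).1 h⟩
  · exact fun e he => he.elim
  · exact fun a ha => ⟨a, ha, rfl⟩
  · exact fun a ha h => ⟨a, ha, rfl, (hw a).2 h⟩
  · exact fun p hp => hp.elim
  · exact fun p hp => hp.elim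
  · exact fun p hp => hp.elim
  · have : {e ∈ (initial ρ σ).indet | e.1 ≠ none} = ∅ := by
      ext e
      simp only [Set.mem_ofPred_eq, Set.mem_empty_iff_false, iff_false, not_and, not_not]
      rintro ⟨a, -, rfl, -⟩
      rfl
    rw [this]
    exact consistent_future_unanimous hn hσ
  · rintro p ⟨a, -, he, -⟩
    exact absurd (Prod.mk.inj he).1 (by simp)
  · intro γ hγ
    convert Addable.empty
    ext e
    simp only [Set.mem_ofPred_eq, Set.mem_empty_iff_false, iff_false, not_and]
    rintro ⟨a, -, rfl⟩ (h : (2 : ℚ) = γ)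
    linarith

theorem edgesOf_inter_det (hext : ∀ i, σ i <+: σ' i) (hσ' : ∀ i, (σ' i).Nodup) {γ : ℚ}
    (hγ : γ ≤ 1) {O : Status α} (hO : Sound ρ σ (pairs σ) O) {L : List (α × α)}
    (hL : ∀ p, p ∈ L ↔ p ∈ pairs σ' ∧ grade ρ σ' (some p.1, some p.2) = γ) :
    edgesOf L ∩ O.det = {e ∈ O.det | grade ρ σ e = γ} := by
  ext e
  constructor
  · rintro ⟨⟨p, hp, rfl⟩, he⟩
    refine ⟨he, ?_⟩
    rw [← ((hL p).1 hp).2, grade_extend hext hσ' (hO.det_vertices subset_rfl he).2]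
  · rintro ⟨he, hg⟩
    refine ⟨?_, he⟩
    rcases hO.det_shape e he with ⟨a, -, rfl⟩ | ⟨p, hp, rfl⟩
    · have : (2 : ℚ) = γ := hg
      linarith
    · refine ⟨p, (hL p).2 ⟨pairs_extend hext hp, ?_⟩, rfl⟩
      rw [grade_extend hext hσ' (hO.det_vertices subset_rfl he).2, hg]

/-- The decisions of the oracle on the pairs in `M` have been copied. -/
def Agrees (O : Status α) (M : Set (α × α)) (s : Status α) : Prop :=
  ∀ p ∈ M, ((some p.1, some p.2) ∈ O.det → (some p.1, some p.2) ∈ s.det) ∧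
    ((some p.1, some p.2) ∈ O.rejected → (some p.1, some p.2) ∈ s.rejected)

/-- Copied inclusions are admissible because a local path back would collapse to one in the oracle's
graph. Copied rejections stay justified because their paths have been copied and local sets only
grow. -/
theorem Sound.processClass (hn : 0 < n) (hext : ∀ i, σ i <+: σ' i) (hσ' : ∀ i, (σ' i).Nodup)
    (h1 : ρ 1 = 1) {γ : ℚ} (hγ : γ ≤ 1) {O s : Status α} (hO : Sound ρ σ (pairs σ) O)
    (hs : Sound ρ σ' {p ∈ pairs σ' | γ < grade ρ σ' (some p.1, some p.2)} s)
    (hOs : Agrees O {p ∈ pairs σ' | γ < grade ρ σ' (some p.1, some p.2)} s) {L : List (α × α)}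
    (hL : ∀ p, p ∈ L ↔ p ∈ pairs σ' ∧ grade ρ σ' (some p.1, some p.2) = γ)
    (hfirst : L.Pairwise fun p q => weight σ' q.1 q.2 = 1 → weight σ' p.1 p.2 = 1) :
    Sound ρ σ' {p ∈ pairs σ' | γ ≤ grade ρ σ' (some p.1, some p.2)} (processClass σ' O L s) ∧
      Agrees O {p ∈ pairs σ' | γ ≤ grade ρ σ' (some p.1, some p.2)} (processClass σ' O L s) := by
  have hadd : Addable σ' (s.det ∪ s.indet) (edgesOf L ∩ O.det) := by
    rw [edgesOf_inter_det hext hσ' hγ hO hL]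
    refine (hO.addable γ hγ).extend (common_mono hext) fun D hD a b ha hb hab hp => ?_
    exact hO.collapse hn hext hσ' hγ hs (fun p hp hg => (hOs p ⟨hp, hg⟩).2)
      (fun e he => (hD he).1) ha hb hab hp
  have hrej : ∀ p ∈ L, (some p.1, some p.2) ∈ O.rejected →
      PathBack σ' (s.det ∪ (edgesOf L ∩ O.det)) p := by
    intro p hp hr
    obtain ⟨hp1, hp2, -⟩ := hO.mem_of_rejected hr
    refine (hO.rejected_path p hr).mono ?_ (localSet_subset_extend hext hσ' hp1 hp2)
    rintro e ⟨he, hg⟩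
    rw [← grade_extend hext hσ' (by simp [vertices, hp2]), ((hL p).1 hp).2] at hg
    rcases hO.det_shape e he with ⟨a, ha, rfl⟩ | ⟨q, hq, rfl⟩
    · exact Or.inl (hs.future_det a (common_mono hext ha))
    · rw [← grade_extend hext hσ' (by simp [vertices, hq.2.1])] at hg
      have hq' := pairs_extend hext hq
      rcases hg.lt_or_eq with hg | hg
      · exact Or.inl ((hOs q ⟨hq', hg⟩).1 he)
      · exact Or.inr ⟨⟨q, (hL q).2 ⟨hq', hg.symm⟩, rfl⟩, he⟩
  obtain ⟨A, B, C, hst⟩ := exists_classStep (O := O) (fun p hp => ((hL p).1 hp).1)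
    (fun p hp hr => (hs.mem_of_rejected hr).2.ne' ((hL p).1 hp).2)
    (hs.unanimous_subset h1 hγ hL) hfirst hadd hrej
  refine ⟨hs.step hn hσ' h1 hγ hL hst, fun p hp => ?_⟩
  rcases hp.2.lt_or_eq with hg | hg
  · rw [hst.det_eq, hst.rejected_eq]
    exact ⟨fun h => Or.inl ((hOs p ⟨hp.1, hg⟩).1 h), fun h => Or.inl ((hOs p ⟨hp.1, hg⟩).2 h)⟩
  · have hpL : (some p.1, some p.2) ∈ edgesOf L := mem_edgesOf.2 ((hL p).2 ⟨hp.1, hg.symm⟩)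
    rw [hst.det_eq, hst.rejected_eq]
    exact ⟨fun h => Or.inr (hst.oracle_det ⟨hpL, h⟩),
      fun h => Or.inr (hst.oracle_rejected ⟨hpL, h⟩)⟩

theorem Sound.foldl (hn : 0 < n) (hext : ∀ i, σ i <+: σ' i) (hσ' : ∀ i, (σ' i).Nodup)
    (h1 : ρ 1 = 1) {O : Status α} (hO : Sound ρ σ (pairs σ) O) {E : List (α × α)}
    (hE : IsTieBreak ρ σ' E) (ls : List ℚ) (s : Status α) (hsort : ls.Pairwise (· > ·))
    (hls : ∀ γ ∈ ls, γ ≤ 1)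
    (hall : ∀ p ∈ pairs σ', (∀ γ ∈ ls, γ < grade ρ σ' (some p.1, some p.2)) ∨
      grade ρ σ' (some p.1, some p.2) ∈ ls)
    (hs : Sound ρ σ' {p ∈ pairs σ' | ∀ γ ∈ ls, γ < grade ρ σ' (some p.1, some p.2)} s)
    (hOs : Agrees O {p ∈ pairs σ' | ∀ γ ∈ ls, γ < grade ρ σ' (some p.1, some p.2)} s) :
    Sound ρ σ' (pairs σ')
      (ls.foldl (fun s γ => StreamingRankedPairs.processClass σ' O (weightClass ρ σ' E γ) s) s) := by
  induction ls generalizing s with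
  | nil => simpa using hs
  | cons γ ls ih =>
    obtain ⟨hγls, hsort'⟩ := List.pairwise_cons.1 hsort
    have hγ : γ ≤ 1 := hls γ (by simp)
    have e1 : {p ∈ pairs σ' | ∀ γ' ∈ γ :: ls, γ' < grade ρ σ' (some p.1, some p.2)} =
        {p ∈ pairs σ' | γ < grade ρ σ' (some p.1, some p.2)} := by
      ext p
      simp only [Set.mem_ofPred_eq, List.forall_mem_cons]
      exact ⟨fun h => ⟨h.1, h.2.1⟩, fun h => ⟨h.1, h.2, fun γ' h' => (hγls γ' h').trans h.2⟩⟩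
    have e2 : {p ∈ pairs σ' | ∀ γ' ∈ ls, γ' < grade ρ σ' (some p.1, some p.2)} =
        {p ∈ pairs σ' | γ ≤ grade ρ σ' (some p.1, some p.2)} := by
      ext p
      refine ⟨fun h => ⟨h.1, ?_⟩, fun h => ⟨h.1, fun γ' h' => (hγls γ' h').trans_le h.2⟩⟩
      rcases hall p h.1 with h' | h'
      · exact (h' γ (by simp)).le
      · rcases List.mem_cons.1 h' with h' | h'
        · exact h'.ge
        · exact absurd (h.2 _ h') (lt_irrefl _)
    rw [e1] at hs hOs
    have hL : ∀ p, p ∈ weightClass ρ σ' E γ ↔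
        p ∈ pairs σ' ∧ grade ρ σ' (some p.1, some p.2) = γ := by
      intro p
      simp only [weightClass, List.mem_filter, decide_eq_true_eq]
      exact and_congr (hE.mem_iff p.1 p.2) Iff.rfl
    have hfirst : (weightClass ρ σ' E γ).Pairwise
        fun p q => weight σ' q.1 q.2 = 1 → weight σ' p.1 p.2 = 1 := by
      refine (hE.unanimous_first.filter _).imp_of_mem fun {p q} hp hq h => h ?_
      exact ((hL p).1 hp).2.trans ((hL q).1 hq).2.symm
    obtain ⟨hs', hOs'⟩ := hO.processClass hn hext hσ' h1 hγ hs hOs hL hfirst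
    rw [← e2] at hs' hOs'
    refine ih _ hsort' (fun γ' h => hls γ' (by simp [h])) (fun p hp => ?_) hs' hOs'
    rcases hall p hp with h | h
    · exact Or.inl fun γ' h' => h γ' (by simp [h'])
    · rcases List.mem_cons.1 h with h | h
      · exact Or.inl fun γ' h' => (hγls γ' h').trans_eq h.symm
      · exact Or.inr h

theorem Sound.invoke (hn : 0 < n) (hext : ∀ i, σ i <+: σ' i) (hσ' : ∀ i, (σ' i).Nodup)
    (hρ : Monotone ρ) (h0 : ρ 0 = 0) (h1 : ρ 1 = 1) {O : Status α}
    (hO : Sound ρ σ (pairs σ) O) {E : List (α × α)} (hE : IsTieBreak ρ σ' E) :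
    Sound ρ σ' (pairs σ') (invoke ρ σ' E O) := by
  have hmem : ∀ γ, γ ∈ levels ρ σ' E ↔ ∃ p ∈ pairs σ', grade ρ σ' (some p.1, some p.2) = γ := by
    intro γ
    simp only [levels, Finset.mem_sort, List.mem_toFinset, List.mem_map]
    exact exists_congr fun p => and_congr (hE.mem_iff p.1 p.2) Iff.rfl
  have hempty : {p ∈ pairs σ' | ∀ γ ∈ levels ρ σ' E, γ < grade ρ σ' (some p.1, some p.2)} = ∅ := by
    ext p
    simp only [Set.mem_ofPred_eq, Set.mem_empty_iff_false, iff_false, not_and]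
    exact fun hp h => lt_irrefl _ (h _ ((hmem _).2 ⟨p, hp, rfl⟩))
  refine hO.foldl hn hext hσ' h1 hE _ _ ?_ ?_ ?_ ?_ ?_
  · have hs := Finset.pairwise_sort
      (E.map fun p => roundedWeight ρ σ' (some p.1) (some p.2)).toFinset (fun x y : ℚ => y ≤ x)
    have hd := Finset.sort_nodup
      (E.map fun p => roundedWeight ρ σ' (some p.1) (some p.2)).toFinset (fun x y : ℚ => y ≤ x)
    exact (hs.and hd).imp fun {a b} h => lt_of_le_of_ne h.1 h.2.symm
  · intro γ hγ
    obtain ⟨p, -, rfl⟩ := (hmem γ).1 hγ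
    exact grade_some_le_one hρ h1 _ _
  · exact fun p hp => Or.inr ((hmem _).2 ⟨p, hp, rfl⟩)
  · rw [hempty]
    exact sound_initial hn hσ' h0 h1
  · rw [hempty]
    exact fun p hp => hp.elim

/-- A fictitious invocation on empty votes serves as the oracle of the first one, which then needs
no separate treatment. -/
theorem sound_empty (hn : 0 < n) (ρ : ℚ → ℚ) :
    Sound ρ (fun _ => [] : Votes n α) (pairs (fun _ => [] : Votes n α)) Status.empty := by
  have hc : ∀ a : α, a ∉ common (fun _ => [] : Votes n α) := fun a ha =>
    absurd (ha ⟨0, hn⟩) (by simp)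
  constructor
  · exact fun e he => he.elim
  · exact fun e he => he.elim
  · exact fun e he => he.elim
  · exact fun a ha => absurd ha (hc a)
  · exact fun a ha => absurd ha (hc a)
  · exact fun p hp => absurd hp.1 (hc _)
  · exact fun p hp => absurd hp.1 (hc _)
  · exact fun p hp => hp.elim
  · rintro u v ((h | ⟨a, b, ha, -⟩) | h)
    exacts [h.elim, absurd ha (hc a), h.1.elim]
  · exact fun p hp => hp.elim
  · intro γ _
    convert Addable.empty
    ext e
    simp [Status.empty]

theorem Execution.sound_status (X : Execution n α) (hn : 0 < n) (hρ : Monotone ρ) (h0 : ρ 0 = 0)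
    (h1 : ρ 1 = 1) {T : ℕ → ℝ} (hT : Monotone T) {E : ℕ → List (α × α)}
    (hE : ∀ r, IsTieBreak ρ (X.votes (T r)) (E r)) (r : ℕ) :
    Sound ρ (X.votes (T r)) (pairs (X.votes (T r))) (X.status ρ T E r) := by
  induction r with
  | zero =>
    exact (sound_empty hn ρ).invoke hn (fun i => List.nil_prefix) (X.nodup _) hρ h0 h1 (hE 0)
  | succ r ih =>
    exact ih.invoke hn (fun i => X.extend _ _ i (hT r.le_succ)) (X.nodup _) hρ h0 h1 (hE (r + 1))

end Invocations

/-! ### Synchrony -/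

section Synchrony

variable {n : ℕ} {α : Type*} {X : Execution n α} {Δ t : ℝ}

/-- When replica `i` has `b`, it already has `a`, and `a` cannot be reported before it is sent. -/
theorem Execution.Synchronous.sent_lt (hX : X.Synchronous Δ) {i : Fin n} {a b : α}
    (h : Before (X.votes t i) a b) : X.sent a < X.sent b + Δ := by
  obtain ⟨s, hs, hb⟩ := hX b i
  have h' := h.mono (X.extend t (max t s) i (le_max_left _ _))
  have ha := (h'.of_prefix (X.nodup _ i) (X.extend s (max t s) i (le_max_right _ _)) hb).mem_left
  exact (X.causal _ _ _ ha).trans_lt hs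

theorem Execution.Synchronous.mem_votes (hX : X.Synchronous Δ) {a : α} (h : X.sent a + Δ ≤ t)
    (i : Fin n) : a ∈ X.votes t i := by
  obtain ⟨s, hs, ha⟩ := hX a i
  exact (X.extend s t i (hs.le.trans h)).subset ha

theorem Execution.Synchronous.pos (hX : X.Synchronous Δ) (hn : 0 < n) (a : α) : 0 < Δ := by
  obtain ⟨s, hs, ha⟩ := hX a ⟨0, hn⟩
  have := X.causal _ _ _ ha
  linarith

/-- One `Δ` because the witness `p` is still missing from some vote, another because a replica puts
`p` before `a`. -/
theorem Execution.Synchronous.lt_of_future (hX : X.Synchronous Δ) {a : α}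
    (h : streamedWeight (X.votes t) none (some a) = 1) : t < X.sent a + 2 * Δ := by
  obtain ⟨p, ⟨-, j, hj⟩, i, hi⟩ := streamedWeight_none_eq_one.1 h
  have h1 := hX.sent_lt hi
  have h2 : t < X.sent p + Δ := by
    by_contra! h
    exact hj (hX.mem_votes h j)
  linarith

end Synchrony

/-! ### Recent transactions -/

section Recent

variable {n k : ℕ} {α : Type*} {σ : Votes n α} {ρ : ℚ → ℚ} {s : Status α}

theorem RoundsToNearest.add_inv_le (hk : 0 < k) (hρ : RoundsToNearest k ρ) {m : ℤ} {x : ℚ}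
    (h : (m : ℚ) / k < ρ x) : ((m + 1 : ℤ) : ℚ) / k ≤ ρ x := by
  obtain ⟨m', hm'⟩ := (hρ x).1
  rw [hm'] at h ⊢
  have hk' : (0 : ℚ) < k := by exact_mod_cast hk
  rw [div_lt_div_iff_of_pos_right hk'] at h
  rw [div_le_div_iff_of_pos_right hk']
  exact_mod_cast h

/-- If `(a, b)` is not unanimous, the path from `b` through the future vertex to `a` is local and
present from the start, so the edge could not have become determinate. -/
theorem Sound.future_of_det (hn : 0 < n) (hσ : ∀ i, (σ i).Nodup) (hρ : Monotone ρ) (h1 : ρ 1 = 1)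
    (h : Sound ρ σ (pairs σ) s) {a b : α} (hab : (some a, some b) ∈ s.det)
    (ha : streamedWeight σ none (some a) = 1) : streamedWeight σ none (some b) = 1 := by
  obtain ⟨hac, hbc, hne⟩ := h.mem_of_det (p := (a, b)) hab
  by_cases hw : weight σ a b = 1
  · exact streamedWeight_none_trans hn hσ ha hw
  exfalso
  have hγ := grade_some_le_one (σ := σ) hρ h1 a b
  have h2 : grade ρ σ (some a, some b) < 2 := by linarith
  obtain ⟨a', b', -, -, -, he, hno⟩ := (h.addable _ hγ).exists_of_mem ⟨hab, rfl⟩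
  obtain ⟨h3, h4⟩ := Prod.mk.inj he
  obtain rfl := Option.some.inj h3
  obtain rfl := Option.some.inj h4
  obtain ⟨haU, hbU⟩ := mem_localSet_endpoints hn hσ hac hbc hne hw
  exact hno (.tail (.single ⟨hbU, none_mem_localSet, Or.inl (h.future_det _ hbc), h2⟩)
    ⟨none_mem_localSet, haU, Or.inr (h.future_indet _ hac ha), h2⟩)

theorem Sound.future_of_reaches (hn : 0 < n) (hσ : ∀ i, (σ i).Nodup) (hρ : Monotone ρ)
    (h1 : ρ 1 = 1) (h : Sound ρ σ (pairs σ) s) {a b : α} (hab : Reaches s.det (some a) (some b))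
    (ha : streamedWeight σ none (some a) = 1) : streamedWeight σ none (some b) = 1 := by
  refine hab.closed (W := {x | ∀ y, x = some y → streamedWeight σ none (some y) = 1}) ?_ ?_ b rfl
  · rintro y hy
    rwa [← hy]
  · rintro u v huv hu y rfl
    rcases h.det_shape _ huv with ⟨a, -, he⟩ | ⟨p, -, he⟩
    · exact absurd (Prod.mk.inj he).2 (by simp)
    · obtain ⟨rfl, he'⟩ := Prod.mk.inj he
      rw [he'] at huv ⊢
      exact h.future_of_det hn hσ hρ h1 huv (hu _ rfl)

/-- The graph that consists of all determinate edges and the indeterminate edges of grade more than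
`γ`. -/
def graphAbove (ρ : ℚ → ℚ) (σ : Votes n α) (s : Status α) (γ : ℚ) : Set (Option α × Option α) :=
  s.det ∪ {e ∈ s.indet | γ < grade ρ σ e}

theorem graphAbove_antitone {γ γ' : ℚ} (h : γ ≤ γ') : graphAbove ρ σ s γ' ⊆ graphAbove ρ σ s γ :=
  Set.union_subset_union_right _ fun _ he => ⟨he.1, h.trans_lt he.2⟩

theorem Sound.reaches_cases (hn : 0 < n) (hσ : ∀ i, (σ i).Nodup) (hρ : Monotone ρ)
    (h1 : ρ 1 = 1) (h : Sound ρ σ (pairs σ) s) {γ : ℚ} {x : α}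
    (hx : Reaches (graphAbove ρ σ s γ) none (some x)) :
    streamedWeight σ none (some x) = 1 ∨ ∃ p : α × α, (some p.1, some p.2) ∈ s.indet ∧
      γ < grade ρ σ (some p.1, some p.2) ∧ Reaches s.det (some p.2) (some x) := by
  rcases hx.last_edge (D := s.det) with hx | ⟨u, v, -, huv, huvD, hvx⟩
  · rcases Relation.ReflTransGen.cases_head hx with hx | ⟨v, hv, -⟩
    · exact absurd hx (by simp)
    · rcases h.det_shape _ hv with ⟨a, -, he⟩ | ⟨p, -, he⟩
      · exact absurd (Prod.mk.inj he).1 (by simp)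
      · exact absurd (Prod.mk.inj he).1 (by simp)
  · obtain ⟨huv, hg⟩ := huv.resolve_left huvD
    rcases h.indet_shape _ huv with ⟨a, -, he, ha⟩ | ⟨p, -, he⟩
    · rw [(Prod.mk.inj he).2] at hvx
      exact Or.inl (h.future_of_reaches hn hσ hρ h1 hvx ha)
    · rw [he] at huv hg
      rw [(Prod.mk.inj he).2] at hvx
      exact Or.inr ⟨p, huv, hg, hvx⟩

/-- Otherwise all replicas put `x` before `p.1`, and this unanimous edge completes a path back for
`p`. -/
theorem Sound.exists_before (hn : 0 < n) (hσ : ∀ i, (σ i).Nodup) (h : Sound ρ σ (pairs σ) s)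
    {p : α × α} (hp : (some p.1, some p.2) ∈ s.indet) {x : α}
    (hx : Reaches s.det (some p.2) (some x)) : ∃ i, Before (σ i) p.1 x := by
  have hno := h.not_reaches (Or.inr hp)
  have hx' := hx.mono (Set.subset_union_left (t := unanimous σ))
  obtain ⟨h1, h2, -⟩ := h.mem_of_indet hp
  have hxc : x ∈ common σ := hx.mem_vertices (σ := σ) (fun u v huv => h.det_vertices subset_rfl huv)
    (by simp [vertices, h2]) x rfl
  have hne : p.1 ≠ x := by
    rintro rfl
    exact hno hx'
  refine StreamingRankedPairs.exists_before fun hw => hno (hx'.tail (Or.inr ?_))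
  have := weight_add hn hσ h1 hxc hne
  exact ⟨x, p.1, hxc, h1, hne.symm, by linarith, rfl⟩

/-- Induction on the number `j` of admitted rounded weights, counted down from `1`. Each passage to
the tail of the last indeterminate edge uses up one of them and costs one `Δ`. -/
theorem Sound.lt_sent {X : Execution n α} {Δ t : ℝ} (hX : X.Synchronous Δ) (hn : 0 < n)
    (hk : 0 < k) (hρ : RoundsToNearest k ρ) (h : Sound ρ (X.votes t) (pairs (X.votes t)) s) (j : ℕ)
    {x : α} (hx : Reaches (graphAbove ρ (X.votes t) s (((k - j : ℤ) : ℚ) / k)) none (some x)) :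
    t < X.sent x + (2 + j) * Δ := by
  have hΔ := hX.pos hn x
  have hk' : (0 : ℚ) < k := by exact_mod_cast hk
  have h1 := hρ.apply_one hk
  induction j generalizing x with
  | zero =>
    rcases h.reaches_cases hn (X.nodup t) hρ.monotone h1 hx with hx | ⟨p, -, hg, -⟩
    · simpa using hX.lt_of_future hx
    · have := grade_some_le_one (σ := X.votes t) hρ.monotone h1 p.1 p.2
      simp only [Nat.cast_zero, sub_zero, Int.cast_natCast, div_self hk'.ne'] at hg
      exact absurd hg this.not_gt
  | succ j ih =>
    rcases h.reaches_cases hn (X.nodup t) hρ.monotone h1 hx with hx | ⟨p, hp, hg, hpx⟩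
    · have := hX.lt_of_future hx
      push_cast
      nlinarith [mul_nonneg (Nat.cast_nonneg (α := ℝ) j) hΔ.le]
    · have hle := hρ.add_inv_le hk hg
      obtain ⟨i, hi⟩ := h.exists_before hn (X.nodup t) hp hpx
      have hlt := hX.sent_lt hi
      have := ih ((h.indet_reaches p hp).mono (graphAbove_antitone (γ := ((k - j : ℤ) : ℚ) / k) ?_))
      · push_cast
        linarith
      · rw [grade_some]
        convert hle using 2
        push_cast
        ring

/-- Old transactions cannot be reached from the future vertex. -/
theorem Sound.not_reaches_of_old {X : Execution n α} {Δ t : ℝ} (hX : X.Synchronous Δ) (hn : 0 < n)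
    (hk : 0 < k) (hρ : RoundsToNearest k ρ) (h : Sound ρ (X.votes t) (pairs (X.votes t)) s)
    {x : α} (hx : X.sent x + ((k : ℝ) + 2) * Δ ≤ t) :
    ¬ Reaches (graphAbove ρ (X.votes t) s (-1)) none (some x) := by
  intro hr
  have hΔ := hX.pos hn x
  have hk' : (0 : ℚ) < k := by exact_mod_cast hk
  have hk1 : (1 : ℝ) ≤ k := by exact_mod_cast hk
  have hkΔ : Δ ≤ k * Δ := le_mul_of_one_le_left hΔ.le hk1
  have h1 := hρ.apply_one hk
  have hnd := X.nodup t
  have hcases : ∀ {γ : ℚ} {y : α}, Reaches (graphAbove ρ (X.votes t) s γ) none (some y) →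
      t < X.sent y + 2 * Δ ∨ ∃ p : α × α, (some p.1, some p.2) ∈ s.indet ∧
        γ < grade ρ (X.votes t) (some p.1, some p.2) ∧ Reaches s.det (some p.2) (some y) :=
    fun hy => (h.reaches_cases hn hnd hρ.monotone h1 hy).imp_left hX.lt_of_future
  have hgrade : ∀ p : α × α, 0 ≤ grade ρ (X.votes t) (some p.1, some p.2) := fun p =>
    hρ.apply_zero.ge.trans (hρ.monotone weight_nonneg)
  -- Positive rounded weights alone respect the bound. What remains is a last indeterminate edge `p`
  -- that may have rounded weight `0`.
  have hx0 : ¬ Reaches (graphAbove ρ (X.votes t) s 0) none (some x) := by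
    intro h0
    have := h.lt_sent hX hn hk hρ k (x := x) (by simpa using h0)
    linarith
  rcases hcases hr with hr | ⟨p, hp, -, hpx⟩
  · linarith
  obtain ⟨i, hi⟩ := h.exists_before hn hnd hp hpx
  have hpx_lt := hX.sent_lt hi
  have hp0 : Reaches (graphAbove ρ (X.votes t) s 0) none (some p.1) :=
    (h.indet_reaches p hp).mono (graphAbove_antitone (hgrade p))
  rcases hcases hp0 with hp0 | ⟨q, hq, hq0, hqp⟩
  · linarith
  have hq1 := h.indet_reaches q hq
  have hq2 : Reaches (graphAbove ρ (X.votes t) s 0) none (some q.2) :=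
    (hq1.mono (graphAbove_antitone hq0.le)).tail (Or.inr ⟨hq, hq0⟩)
  -- As `q` has rounded weight at least `1/k`, its tail is reached through rounded weights above
  -- `1/k`. This is `Sound.lt_sent` with `j = k - 1`.
  have hqlt : t < X.sent q.1 + (k + 1) * Δ := by
    have hle := hρ.add_inv_le hk (m := 0) (x := weight (X.votes t) q.1 q.2) (by simpa [grade_some] using hq0)
    have := h.lt_sent hX hn hk hρ (k - 1) (x := q.1) (hq1.mono (graphAbove_antitone ?_))
    · rw [Nat.cast_sub hk] at this
      push_cast at this
      linarith
    · rw [grade_some]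
      convert hle using 2
      rw [Nat.cast_sub hk]
      push_cast
      ring
  have hxc : x ∈ common (X.votes t) := fun i => hX.mem_votes (by nlinarith) i
  have hq2c := (h.mem_of_indet hq).2.1
  have hne : x ≠ q.2 := by
    rintro rfl
    exact hx0 hq2
  -- Now `x` is more than `Δ` older than `q.1`, so no replica puts `q.2` before `x` and `q.1` before
  -- `q.2`. Hence `(x, q.2)` weighs at least as much as `q`, and each possible decision on it is
  -- contradictory.
  have hg : 0 < grade ρ (X.votes t) (some x, some q.2) := by
    refine hq0.trans_le (hρ.monotone (weight_mono fun i hi => ?_))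
    refine (before_total (hnd i) (hxc i) (hq2c i) hne).resolve_right fun hi' => ?_
    have := hX.sent_lt (hi.trans (hnd i) hi')
    linarith
  rcases h.total (x, q.2) ⟨hxc, hq2c, hne⟩ with (hd | hd) | hd
  · refine h.not_reaches (Or.inr hp) (Reaches.mono Set.subset_union_left ?_)
    exact (hpx.tail hd).trans hqp
  · exact hx0 (hq2.trans ((h.reaches_of_rejected hd).mono Set.subset_union_left))
  · exact hx0 ((h.indet_reaches (x, q.2) hd).mono (graphAbove_antitone hg.le))

end Recent

/-! ### Outputs -/

section Outputs

variable {n : ℕ} {α : Type*} {σ : Votes n α} {ρ : ℚ → ℚ} {s : Status α}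

/-- Consistency makes determinate reachability a partial order, which extends to a linear one. -/
theorem Sound.exists_isTopologicalSort (hn : 0 < n) (h : Sound ρ σ (pairs σ) s) :
    ∃ l, IsTopologicalSort σ s l := by
  classical
  let R : α → α → Prop := fun a b => Reaches s.det (some a) (some b)
  have hR : IsPartialOrder α R :=
    { refl := fun a => .refl
      trans := fun a b c => Relation.ReflTransGen.trans
      antisymm := by
        intro a b hab hba
        rcases Relation.ReflTransGen.cases_head hab with he | ⟨c, hc, hcb⟩
        · exact Option.some.inj he
        · exact absurd (Reaches.mono Set.subset_union_left (hcb.trans hba))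
            (h.consistent _ _ (Or.inl (Or.inl hc))) }
  obtain ⟨le, hle, hRle⟩ := extend_partialOrder R
  let l := (common_finite (σ := σ) hn).toFinset.sort le
  have hnd : l.Nodup := Finset.sort_nodup _ _
  have hmem : ∀ a, a ∈ l ↔ a ∈ common σ := fun a => by simp [l]
  refine ⟨l, hnd, hmem, fun a b hab => ?_⟩
  obtain ⟨ha, hb, hne⟩ := h.mem_of_det (p := (a, b)) hab
  refine (before_total hnd ((hmem a).2 ha) ((hmem b).2 hb) hne).resolve_right fun hba => ?_
  have hp : l.Pairwise le := Finset.pairwise_sort _ _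
  have hba' : le b a := by simpa using hp.sublist hba
  exact hne (antisymm (r := le) (hRle a b (.single hab)) hba')

theorem mem_takeWhile_of_before {P : α → Bool} {l : List α} (hl : l.Nodup) {a : α} (ha : a ∈ l)
    (hPa : P a) (h : ∀ b ∈ l, b ≠ a → ¬ P b → Before l a b) : a ∈ l.takeWhile P := by
  obtain ⟨l₁, l₂, rfl⟩ := List.append_of_mem ha
  have h₁ : ∀ b ∈ l₁, P b := by
    intro b hb
    by_contra hPb
    have hba : Before (l₁ ++ a :: l₂) b a := before_iff_append.2 ⟨l₁, a :: l₂, rfl, hb, by simp⟩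
    have hne : b ≠ a := by
      rintro rfl
      exact hPb hPa
    exact hba.asymm hl (h b (by simp [hb]) hne hPb)
  rw [List.takeWhile_append_of_pos h₁, List.takeWhile_cons_of_pos hPa]
  simp

theorem Sound.reaches_of_borders {k : ℕ} (hρ : RoundsToNearest k ρ) (h : Sound ρ σ (pairs σ) s)
    {z : α} (hz : Borders s z) : Reaches (graphAbove ρ σ s (-1)) none (some z) := by
  have hgrade : ∀ p : α × α, -1 < grade ρ σ (some p.1, some p.2) := fun p =>
    neg_one_lt_zero.trans_le (hρ.apply_zero.ge.trans (hρ.monotone weight_nonneg))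
  have hreach : ∀ p : α × α, (some p.1, some p.2) ∈ s.indet →
      Reaches (graphAbove ρ σ s (-1)) none (some p.1) := fun p hp =>
    (h.indet_reaches p hp).mono (graphAbove_antitone (hgrade p).le)
  obtain ⟨x, hx | hx⟩ := hz
  · rcases h.indet_shape _ hx with ⟨a, -, he, -⟩ | ⟨p, -, he⟩
    · rw [(Prod.mk.inj he).1] at hx
      exact .single (Or.inr ⟨hx, show (-1 : ℚ) < 2 by norm_num⟩)
    · rw [he] at hx
      rw [(Prod.mk.inj he).2]
      exact (hreach p hx).tail (Or.inr ⟨hx, hgrade p⟩)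
  · rcases h.indet_shape _ hx with ⟨a, -, he, -⟩ | ⟨p, -, he⟩
    · exact absurd (Prod.mk.inj he).1 (by simp)
    · rw [he] at hx
      rw [(Prod.mk.inj he).1]
      exact hreach p hx

/-- Every `z` at an indeterminate edge is reachable from the future vertex. Were `(x, z)` rejected
or indeterminate, `x` would be reachable too. So the edge is determinate and each topological sort
puts `x` before `z`. -/
theorem Sound.mem_output {k : ℕ} (hρ : RoundsToNearest k ρ) (h : Sound ρ σ (pairs σ) s) {x : α}
    (hx : x ∈ common σ) (hxr : ¬ Reaches (graphAbove ρ σ s (-1)) none (some x)) {o : List α}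
    (ho : IsOutput σ s o) : x ∈ o := by
  classical
  obtain ⟨l, hl, rfl⟩ := ho
  refine mem_takeWhile_of_before hl.nodup ((hl.mem_iff x).2 hx) ?_ fun z hz hzx hPz => ?_
  · simpa using fun hb => hxr (h.reaches_of_borders hρ hb)
  · have hzr := h.reaches_of_borders hρ (z := z) (by simpa using hPz)
    rcases h.total (x, z) ⟨hx, (hl.mem_iff z).1 hz, hzx.symm⟩ with (hd | hd) | hd
    · exact hl.sorted _ _ hd
    · exact absurd (hzr.trans ((h.reaches_of_rejected hd).mono Set.subset_union_left)) hxr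
    · exact absurd (h.reaches_of_borders hρ ⟨some z, Or.inr hd⟩) hxr

end Outputs

end StreamingRankedPairs

theorem mainTheorem8 {α : Type*} (n k : ℕ) (hn : 0 < n) (hk : 0 < k)
    (ρ : ℚ → ℚ) (hρ : StreamingRankedPairs.RoundsToNearest k ρ)
    (X : StreamingRankedPairs.Execution n α) (Δ : ℝ) (hX : X.Synchronous Δ)
    (T : ℕ → ℝ) (hT : Monotone T) (E : ℕ → List (α × α))
    (hE : ∀ r, StreamingRankedPairs.IsTieBreak ρ (X.votes (T r)) (E r))
    (τ : α) (r : ℕ) (hr : X.sent τ + ((k : ℝ) + 2) * Δ ≤ T r) :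
    (∃ o, StreamingRankedPairs.IsOutput (X.votes (T r)) (X.status ρ T E r) o) ∧
      ∀ o, StreamingRankedPairs.IsOutput (X.votes (T r)) (X.status ρ T E r) o → τ ∈ o := by
  have h := X.sound_status hn hρ.monotone hρ.apply_zero (hρ.apply_one hk) hT hE r
  obtain ⟨l, hl⟩ := h.exists_isTopologicalSort hn
  refine ⟨⟨_, l, hl, rfl⟩, fun o ho => h.mem_output hρ (fun i => hX.mem_votes ?_ i)
    (h.not_reaches_of_old hX hn hk hρ hr) ho⟩
  have hΔ := hX.pos hn τ
  nlinarith [mul_nonneg (Nat.cast_nonneg (α := ℝ) k) hΔ.le]
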